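/- Let $\mathbb T^2=\mathbb R^2/\mathbb Z^2$ be the unit square $[0,1]^2$ with periodic boundary conditions, with its Borel sets and Lebesgue measure $|\cdot|$. An automorphism of $\mathbb T^2$ is an invertible measurable map $T$ with $|A|=|T(A)|=|T^{-1}(A)|$ for all Borel $A$. It is weakly mixing if $\lim_{n\to\infty}\frac1n\sum_{j=0}^{n-1}\big[|T^{-j}(A)\cap B|-|A||B|\big]^2=0$ for all Borel $A,B$, and strongly mixing if $\lim_{n\to\infty}|T^{-n}(A)\cap B|=|A||B|$ for all Borel $A,B$. **Construction.** For a square $Q$ write $Q(1),Q(2),Q(3),Q(4)$ for its upper left, upper right, lower left and lower right quarters, and let $\mathring Q$ be its interior. For $n\ge 1$ put $l_n=2^{-(n-1)}$, and let $h_1=0$, $h_{n+1}=4h_n+3$, so that $h_n=4^{n-1}-1$. For $m\ge0$ let $R_m=[1-2^{-m},1]\times[0,2^{-m}]$, so that $R_0=[0,1]^2$ and $R_m(4)=R_{m+1}$. The first column has no levels. The $(n+1)$-st column ($n\ge1$) consists of the squares $Q_{n+1,1},\dots,Q_{n+1,h_{n+1}}$ of side $l_{n+1}$, which are, in this order, writing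 $h=h_n$, $$Q_{n,1}(1),\dots,Q_{n,h}(1),\;Q_{n,1}(2),\dots,Q_{n,h}(2),\;R_{n-1}(1),\;Q_{n,1}(3),\dots,Q_{n,h}(3),\;R_{n-1}(2),\;Q_{n,1}(4),\dots,Q_{n,h}(4),\;R_{n-1}(3).$$ In particular $Q_{2,i}=R_0(i)$ for $i=1,2,3$. Define $U_1:\mathbb T^2\to\mathbb T^2$ by $U_1(x)=x+(\frac12,0)$ on $\mathring R_0(1)$, $U_1(x)=x+(-\frac12,-\frac12)$ on $\mathring R_0(2)$, $U_1(x)=x+(0,\frac12)$ on $\mathring R_0(3)$, and $U_1(x)=x$ otherwise. For $n\ge2$ define $$U_n(x)=\begin{cases}U_{n-1}(x), & x\in\mathring Q_{n,1}\cup\dots\cup\mathring Q_{n,h_n-1},\\ x+(\frac5{2^n}-1,\,1-\frac1{2^{n-1}}), & x\in\mathring Q_{n,h_n}(1),\\ x+(\frac1{2^n},0), & x\in\mathring Q_{n,h_n}(2),\\ x+(\frac3{2^n},\frac1{2^n}), & x\in\mathring Q_{n,h_n}(3),\\ x+(\frac1{2^n},0), & x\in\mathring Q_{n,h_n}(4),\\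 x+(\frac1{2^{n-1}}-1,\frac{2^n-3}{2^n}), & x\in\mathring R_{n-1}(1)\cup\mathring R_{n-1}(2),\\ x+(\frac1{2^{n-1}}-1,\frac{2^n-1}{2^n}), & x\in\mathring R_{n-1}(3),\\ x, & \text{otherwise.}\end{cases}$$ **Proposition.** The limit $U(x)=\lim_{n\to\infty}U_n(x)$ exists for every $x\in\mathbb T^2$, and $U$ is a weakly mixing automorphism of $\mathbb T^2$ that is not strongly mixing. Moreover, $$|U^{h_k}(Q_{n,i})\cap Q_{n,i}|\ge\tfrac14|Q_{n,i}|\qquad\text{for all } n\ge2,\ 1\le i\le h_n,\ k\ge n,$$ and every eigenvalue of the Koopman operator $f\mapsto f\circ U$ on $L^2(\mathbb T^2;\mathbb C)$ equals $1$. -/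

import Mathlib

open MeasureTheory Filter Topology Set

/-- The two-dimensional torus `ℝ²/ℤ²`, i.e. the unit square with periodic boundary conditions.
Its `volume` is the product Lebesgue measure, of total mass one. -/
abbrev Torus2 : Type := UnitAddCircle × UnitAddCircle

/-- The canonical projection of the plane onto the torus. -/
def toTorus2 (p : ℝ × ℝ) : Torus2 := ((p.1 : UnitAddCircle), (p.2 : UnitAddCircle))

/-! ### Notions of ergodic theory -/

/-- Automorphisms of the measure space `Torus2`: invertible, measurable, and
`|A| = |T(A)| = |T⁻¹(A)|` for every Borel set `A`. -/
def IsTorusAutomorphism (T : Torus2 → Torus2) : Prop :=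
  Function.Bijective T ∧ Measurable T ∧
    ∀ A : Set Torus2, MeasurableSet A →
      volume (T '' A) = volume A ∧ volume (T ⁻¹' A) = volume A

/-- Weak mixing: the Cesàro means of `(|T⁻ʲ(A) ∩ B| - |A||B|)²` tend to `0`. -/
def IsWeaklyMixing (T : Torus2 → Torus2) : Prop :=
  ∀ A B : Set Torus2, MeasurableSet A → MeasurableSet B →
    Tendsto (fun n : ℕ => (1 / (n : ℝ)) * ∑ j ∈ Finset.range n,
        (volume.real ((T^[j]) ⁻¹' A ∩ B) - volume.real A * volume.real B) ^ 2)
      atTop (𝓝 0)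

/-- Strong mixing: `|T⁻ⁿ(A) ∩ B| → |A||B|`. -/
def IsStronglyMixing (T : Torus2 → Torus2) : Prop :=
  ∀ A B : Set Torus2, MeasurableSet A → MeasurableSet B →
    Tendsto (fun n : ℕ => volume.real ((T^[n]) ⁻¹' A ∩ B))
      atTop (𝓝 (volume.real A * volume.real B))

/-! ### Squares

A square of the torus is given by its lower left corner `p ∈ [0,1]²` and its side `l`. -/

/-- The open square with lower left corner `p` and side `l`. -/
def openSquare (p : ℝ × ℝ) (l : ℝ) : Set Torus2 :=
  toTorus2 '' (Ioo p.1 (p.1 + l) ×ˢ Ioo p.2 (p.2 + l))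

/-- The closed square with lower left corner `p` and side `l`. -/
def closedSquare (p : ℝ × ℝ) (l : ℝ) : Set Torus2 :=
  toTorus2 '' (Icc p.1 (p.1 + l) ×ˢ Icc p.2 (p.2 + l))

/-- Cutting the square with corner `p` and side `l` into four: the lower left corner of its
`q`-th quarter (of side `l / 2`), where the quarters are numbered
`1` = upper left, `2` = upper right, `3` = lower left, `4` = lower right. -/
noncomputable def quarter (p : ℝ × ℝ) (l : ℝ) : ℕ → ℝ × ℝ
  | 1 => (p.1, p.2 + l / 2)
  | 2 => (p.1 + l / 2, p.2 + l / 2)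
  | 3 => (p.1, p.2)
  | _ => (p.1 + l / 2, p.2)

/-! ### Columns -/

/-- The side `l_n = 1 / 2^(n-1)` of the levels of the `n`-th column (`n ≥ 1`). -/
noncomputable def levelSide (n : ℕ) : ℝ := 2 / 2 ^ n

/-- The height `h_n` of the `n`-th column: `h_1 = 0` and `h_{n+1} = 4 h_n + 3`
(the value at `0` is not used). -/
def columnHeight : ℕ → ℕ
  | 0 => 0
  | 1 => 0
  | n + 2 => 4 * columnHeight (n + 1) + 3

/-- The lower left corner of the remaining square `R_m = [1 - 1/2^m, 1] × [0, 1/2^m]`,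
whose side is `l_{m+1}`; `R_0` is the whole unit square. -/
noncomputable def remainderCorner (m : ℕ) : ℝ × ℝ := (1 - levelSide (m + 1), 0)

/-- The lower left corner of the level `Q_{n,i}`, `1 ≤ i ≤ h_n`, of the `n`-th column.

The column of index `1` has no levels. From the column of index `N` (here `N = n + 1`), the next
one is obtained by cutting every level and the remaining square `R_{N-1}` into quarters and
stacking, from the bottom:
`Q_{N,1}(1), …, Q_{N,h}(1), Q_{N,1}(2), …, Q_{N,h}(2), R_{N-1}(1), Q_{N,1}(3), …, Q_{N,h}(3),
R_{N-1}(2), Q_{N,1}(4), …, Q_{N,h}(4), R_{N-1}(3)` with `h = h_N`, leaving `R_N = R_{N-1}(4)`.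
In particular `Q_{2,1}, Q_{2,2}, Q_{2,3}` are the first three quarters of the unit square. -/
noncomputable def levelCorner : ℕ → ℕ → ℝ × ℝ
  | 0, _ => (0, 0)
  | 1, _ => (0, 0)
  | n + 2, j =>
      let h := columnHeight (n + 1)
      let l := levelSide (n + 1)
      if j ≤ h then quarter (levelCorner (n + 1) j) l 1
      else if j ≤ 2 * h then quarter (levelCorner (n + 1) (j - h)) l 2
      else if j = 2 * h + 1 then quarter (remainderCorner n) l 1
      else if j ≤ 3 * h + 1 then quarter (levelCorner (n + 1) (j - (2 * h + 1))) l 3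
      else if j = 3 * h + 2 then quarter (remainderCorner n) l 2
      else if j ≤ 4 * h + 2 then quarter (levelCorner (n + 1) (j - (3 * h + 2))) l 4
      else quarter (remainderCorner n) l 3

/-- The level `Q_{n,i}` as a closed square. -/
def level (n i : ℕ) : Set Torus2 := closedSquare (levelCorner n i) (levelSide n)

/-- The interior of the level `Q_{n,i}`. -/
def openLevel (n i : ℕ) : Set Torus2 := openSquare (levelCorner n i) (levelSide n)

/-- The interior of the quarter `Q_{n,h_n}(q)` of the last level of the `n`-th column. -/
noncomputable def lastQuarter (n q : ℕ) : Set Torus2 :=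
  openSquare (quarter (levelCorner n (columnHeight n)) (levelSide n) q) (levelSide n / 2)

/-- The interior of the quarter `R_m(q)` of the remaining square `R_m`. -/
noncomputable def remainderQuarter (m q : ℕ) : Set Torus2 :=
  openSquare (quarter (remainderCorner m) (levelSide (m + 1)) q) (levelSide (m + 1) / 2)

/-! ### The maps `U_n` and their limit -/

open Classical in
/-- The maps `U_n`, `n ≥ 1` (`U_0` is not used). `U_n` agrees with `U_{n-1}` inside the levels
`Q_{n,1}, …, Q_{n,h_n - 1}`, translates
`Q_{n,h_n}(1) → Q_{n,1}(2)`, `Q_{n,h_n}(2) → R_{n-1}(1) → Q_{n,1}(3)`,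
`Q_{n,h_n}(3) → R_{n-1}(2) → Q_{n,1}(4)`, `Q_{n,h_n}(4) → R_{n-1}(3) → Q_{n,1}(1)`,
and is the identity elsewhere. -/
noncomputable def chaconStep : ℕ → Torus2 → Torus2
  | 0, x => x
  | 1, x =>
      if x ∈ remainderQuarter 0 1 then x + toTorus2 (1 / 2, 0)
      else if x ∈ remainderQuarter 0 2 then x + toTorus2 (-1 / 2, -1 / 2)
      else if x ∈ remainderQuarter 0 3 then x + toTorus2 (0, 1 / 2)
      else x
  | n + 2, x =>
      if ∃ i, 1 ≤ i ∧ i < columnHeight (n + 2) ∧ x ∈ openLevel (n + 2) i then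
        chaconStep (n + 1) x
      else if x ∈ lastQuarter (n + 2) 1 then
        x + toTorus2 (5 / 2 ^ (n + 2) - 1, 1 - 1 / 2 ^ (n + 1))
      else if x ∈ lastQuarter (n + 2) 2 then
        x + toTorus2 (1 / 2 ^ (n + 2), 0)
      else if x ∈ lastQuarter (n + 2) 3 then
        x + toTorus2 (3 / 2 ^ (n + 2), 1 / 2 ^ (n + 2))
      else if x ∈ lastQuarter (n + 2) 4 then
        x + toTorus2 (1 / 2 ^ (n + 2), 0)
      else if x ∈ remainderQuarter (n + 1) 1 then
        x + toTorus2 (1 / 2 ^ (n + 1) - 1, (2 ^ (n + 2) - 3) / 2 ^ (n + 2))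
      else if x ∈ remainderQuarter (n + 1) 2 then
        x + toTorus2 (1 / 2 ^ (n + 1) - 1, (2 ^ (n + 2) - 3) / 2 ^ (n + 2))
      else if x ∈ remainderQuarter (n + 1) 3 then
        x + toTorus2 (1 / 2 ^ (n + 1) - 1, (2 ^ (n + 2) - 1) / 2 ^ (n + 2))
      else x

/-- The two-dimensional Chacon map `U = lim U_n` (pointwise limit). -/
noncomputable def chaconMap (x : Torus2) : Torus2 :=
  limUnder atTop (fun n => chaconStep n x)

/-! ### Instances -/

/-! Everything is reduced to dyadic bookkeeping on the regular points, those with no dyadic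
coordinate. They form an invariant set of full measure, and on it open, closed and half-open dyadic
squares agree. A level of the column of index `N + 1` is a cell of order `N` of the dyadic grid, and
the column lists every such cell once, except the remaining corner cell. On any level but the top
one, `U` is the translation to the next level (`chaconMap_eq_add_cellShift`). Each point is
eventually in an intermediate level, which gives convergence on regular points; the others are
eventually fixed. Bijectivity follows by climbing and descending a common column, and invariance of
the measure from the fact that `U` moves points by vectors of a countable set.

Weak mixing comes from ergodicity of `U × U`. With h the height of a column, the stacking makes
`U^h` a translation by a small vector v on the first quarters of the levels (no spacer), and
`U^(h+1)` a translation by a small vector w on the second quarters (one spacer). If A is invariant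
under `U × U`, then (x, Uy) and (x, y) + (v, w) are together in A or not, for x in a first and y in
a second quarter. Translations being continuous in measure, A is almost invariant under `id × U`
(`preimage_id_prodMap_ae_eq`), hence also under `U × id`. Dyadic translations run along orbits of
`U`, so A is almost invariant under a dense group of translations and is null or conull
(`ergodic_prodMap_of_orbit`).

Ergodicity of the square gives weak mixing through the mean ergodic theorem, and trivial eigenvalues
because f(x) times the conjugate of f(y) is invariant for an eigenfunction f. The same return time h
brings the first quarters of a level onto the second ones, so a quarter of each level returns for
all large columns; a level of measure below 1/4 then contradicts strong mixing. -/

instance : (volume : Measure Torus2).IsAddHaarMeasure :=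
  Measure.prod.instIsAddHaarMeasure _ _

instance : IsProbabilityMeasure (volume : Measure UnitAddCircle) :=
  ⟨UnitAddCircle.measure_univ⟩

instance : IsProbabilityMeasure (volume : Measure Torus2) :=
  inferInstanceAs (IsProbabilityMeasure ((volume : Measure UnitAddCircle).prod volume))

instance : (volume : Measure (Torus2 × Torus2)).IsAddHaarMeasure :=
  Measure.prod.instIsAddHaarMeasure _ _

instance : IsProbabilityMeasure (volume : Measure (Torus2 × Torus2)) :=
  inferInstanceAs (IsProbabilityMeasure ((volume : Measure Torus2).prod volume))

/-! ### Dyadic digits on the circle -/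

/-- The representative in `[0, 1)` of a point of the circle. -/
noncomputable def circleRep (u : UnitAddCircle) : ℝ := (AddCircle.equivIco (1 : ℝ) 0 u : ℝ)

/-- The index `a` of the dyadic interval `[a / 2 ^ N, (a + 1) / 2 ^ N)` containing `u`. -/
noncomputable def dyadicIndex (N : ℕ) (u : UnitAddCircle) : ℕ := ⌊2 ^ N * circleRep u⌋₊

/-- The dyadic rationals modulo one. -/
def IsDyadic (u : UnitAddCircle) : Prop := ∃ N : ℕ, (2 ^ N : ℕ) • u = 0

theorem circleRep_nonneg (u : UnitAddCircle) : 0 ≤ circleRep u :=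
  (AddCircle.equivIco (1 : ℝ) 0 u).2.1

theorem circleRep_lt_one (u : UnitAddCircle) : circleRep u < 1 := by
  exact (AddCircle.equivIco (1 : ℝ) 0 u).2.2.trans_eq (zero_add 1)

theorem coe_circleRep (u : UnitAddCircle) : ((circleRep u : ℝ) : UnitAddCircle) = u :=
  (AddCircle.equivIco (1 : ℝ) 0).symm_apply_apply u

theorem circleRep_coe {s : ℝ} (h0 : 0 ≤ s) (h1 : s < 1) : circleRep (s : UnitAddCircle) = s := by
  rw [circleRep, AddCircle.coe_equivIco_mk_apply, div_one, mul_one]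
  exact Int.fract_eq_self.2 ⟨h0, h1⟩

theorem measurable_circleRep : Measurable circleRep :=
  measurable_subtype_coe.comp (AddCircle.measurableEquivIco (1 : ℝ) 0).measurable

theorem measurable_dyadicIndex (N : ℕ) : Measurable (dyadicIndex N) :=
  Nat.measurable_floor.comp (measurable_circleRep.const_mul _)

theorem dyadicIndex_lt (N : ℕ) (u : UnitAddCircle) : dyadicIndex N u < 2 ^ N := by
  rw [dyadicIndex, Nat.floor_lt (mul_nonneg (by positivity) (circleRep_nonneg u))]
  push_cast
  exact mul_lt_of_lt_one_right (by positivity) (circleRep_lt_one u)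

theorem dyadicIndex_eq_iff {N a : ℕ} {u : UnitAddCircle} :
    dyadicIndex N u = a ↔ (a : ℝ) / 2 ^ N ≤ circleRep u ∧ circleRep u < (a + 1) / 2 ^ N := by
  rw [dyadicIndex, Nat.floor_eq_iff (mul_nonneg (by positivity) (circleRep_nonneg u)),
    div_le_iff₀' (by positivity), lt_div_iff₀' (by positivity)]

theorem dyadicIndex_succ_div (N : ℕ) (u : UnitAddCircle) :
    dyadicIndex (N + 1) u / 2 = dyadicIndex N u := by
  have := Nat.floor_div_natCast (2 ^ (N + 1) * circleRep u) 2
  rw [dyadicIndex, ← this, dyadicIndex]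
  congr 1
  push_cast
  ring

theorem dyadicIndex_add_div (N k : ℕ) (u : UnitAddCircle) :
    dyadicIndex (N + k) u / 2 ^ k = dyadicIndex N u := by
  induction k with
  | zero => simp
  | succ k ih =>
    rw [pow_succ', ← Nat.div_div_eq_div_mul, ← add_assoc, dyadicIndex_succ_div, ih]

theorem circleRep_add {N a b : ℕ} {u : UnitAddCircle} (h : dyadicIndex N u = a)
    (hb : b < 2 ^ N) :
    circleRep (u + (((b : ℝ) - a) / 2 ^ N : ℝ)) = circleRep u + ((b : ℝ) - a) / 2 ^ N := by
  obtain ⟨h1, h2⟩ := dyadicIndex_eq_iff.1 h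
  have hb' : (b : ℝ) + 1 ≤ 2 ^ N := by exact_mod_cast hb
  have e : u + (((b : ℝ) - a) / 2 ^ N : ℝ) =
      ((circleRep u + ((b : ℝ) - a) / 2 ^ N : ℝ) : UnitAddCircle) := by
    rw [AddCircle.coe_add, coe_circleRep]
  rw [e, circleRep_coe]
  · rw [sub_div]
    have : (0 : ℝ) ≤ b / 2 ^ N := by positivity
    linarith
  · rw [sub_div]
    rw [add_div] at h2
    have : ((b : ℝ) + 1) / 2 ^ N ≤ 1 := by
      rw [div_le_one (by positivity)]; exact hb'
    rw [add_div] at this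
    linarith

theorem dyadicIndex_add {N a b : ℕ} {u : UnitAddCircle} (h : dyadicIndex N u = a)
    (hb : b < 2 ^ N) : dyadicIndex N (u + (((b : ℝ) - a) / 2 ^ N : ℝ)) = b := by
  rw [dyadicIndex_eq_iff, circleRep_add h hb]
  obtain ⟨h1, h2⟩ := dyadicIndex_eq_iff.1 h
  rw [add_div, sub_div] at *
  constructor <;> linarith

/-- A translation by a dyadic vector is determined by the change of the dyadic index. -/
theorem eq_coe_dyadicIndex_sub {N : ℕ} {t : UnitAddCircle} (ht : (2 ^ N : ℕ) • t = 0)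
    (u : UnitAddCircle) :
    t = ((((dyadicIndex N (u + t) : ℝ) - dyadicIndex N u) / 2 ^ N : ℝ) : UnitAddCircle) := by
  obtain ⟨m, hm⟩ : ∃ m : ℤ, (m : ℝ) = 2 ^ N * (circleRep (u + t) - circleRep u) := by
    have : ((2 ^ N * (circleRep (u + t) - circleRep u) : ℝ) : UnitAddCircle) = 0 := by
      have e : (2 ^ N * (circleRep (u + t) - circleRep u) : ℝ) =
          (2 ^ N : ℕ) • (circleRep (u + t) - circleRep u) := by
        rw [nsmul_eq_mul]; push_cast; rfl
      rw [e, AddCircle.coe_nsmul, AddCircle.coe_sub, coe_circleRep, coe_circleRep,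
        add_sub_cancel_left, ht]
    obtain ⟨m, hm⟩ := (AddCircle.coe_eq_zero_iff (1 : ℝ)).1 this
    exact ⟨m, by simpa using hm⟩
  have hfl : (dyadicIndex N (u + t) : ℤ) = dyadicIndex N u + m := by
    have h1 := circleRep_nonneg (u + t)
    have h2 := circleRep_nonneg u
    rw [dyadicIndex, dyadicIndex, Int.natCast_floor_eq_floor (by positivity),
      Int.natCast_floor_eq_floor (by positivity), ← Int.floor_add_intCast, hm]
    congr 1
    ring
  have hfl' : (dyadicIndex N (u + t) : ℝ) - dyadicIndex N u = m := by
    have : ((dyadicIndex N (u + t) : ℤ) : ℝ) = ((dyadicIndex N u + m : ℤ) : ℝ) := by rw [hfl]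
    push_cast at this
    linarith
  rw [hfl', hm, mul_div_cancel_left₀ _ (by positivity), AddCircle.coe_sub, coe_circleRep,
    coe_circleRep, add_sub_cancel_left]

/-- The margin 2 excludes the indices `2 ^ N - 1` and `2 ^ N - 2`: these are the coordinates that
mark the remaining square and the first level, and the last level, respectively. -/
theorem eventually_dyadicIndex_add_two_lt (u : UnitAddCircle) :
    ∀ᶠ N in atTop, dyadicIndex N u + 2 < 2 ^ N := by
  have h : Tendsto (fun N : ℕ => (2 : ℝ) ^ N * (1 - circleRep u)) atTop atTop :=
    (tendsto_pow_atTop_atTop_of_one_lt one_lt_two).atTop_mul_const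
      (sub_pos.2 (circleRep_lt_one u))
  filter_upwards [h.eventually_gt_atTop 2] with N hN
  have h1 : (dyadicIndex N u : ℝ) ≤ 2 ^ N * circleRep u :=
    Nat.floor_le (mul_nonneg (by positivity) (circleRep_nonneg u))
  have : (dyadicIndex N u : ℝ) + 2 < 2 ^ N := by linarith
  exact_mod_cast this

theorem isDyadic_zero : IsDyadic 0 := ⟨0, by simp⟩

theorem two_pow_nsmul_eq_zero_of_le {N M : ℕ} (h : N ≤ M) {u : UnitAddCircle}
    (hu : (2 ^ N : ℕ) • u = 0) : (2 ^ M : ℕ) • u = 0 := by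
  obtain ⟨k, rfl⟩ := Nat.exists_eq_add_of_le h
  rw [pow_add, mul_comm, mul_smul, hu, smul_zero]

theorem IsDyadic.add {u v : UnitAddCircle} (hu : IsDyadic u) (hv : IsDyadic v) :
    IsDyadic (u + v) := by
  obtain ⟨N, hN⟩ := hu
  obtain ⟨M, hM⟩ := hv
  refine ⟨max N M, ?_⟩
  rw [smul_add, two_pow_nsmul_eq_zero_of_le (le_max_left N M) hN,
    two_pow_nsmul_eq_zero_of_le (le_max_right N M) hM, add_zero]

theorem IsDyadic.neg {u : UnitAddCircle} (hu : IsDyadic u) : IsDyadic (-u) := by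
  obtain ⟨N, hN⟩ := hu
  exact ⟨N, by rw [smul_neg, hN, neg_zero]⟩

theorem two_pow_nsmul_coe_intCast_div (N : ℕ) (m : ℤ) :
    (2 ^ N : ℕ) • (((m : ℝ) / 2 ^ N : ℝ) : UnitAddCircle) = 0 := by
  rw [← AddCircle.coe_nsmul, nsmul_eq_mul, AddCircle.coe_eq_zero_iff]
  refine ⟨m, ?_⟩
  rw [zsmul_one]
  push_cast
  field_simp

theorem isDyadic_coe_sub_div (N a b : ℕ) :
    IsDyadic (((((b : ℝ) - a) / 2 ^ N : ℝ)) : UnitAddCircle) :=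
  ⟨N, by simpa using two_pow_nsmul_coe_intCast_div N (b - a)⟩

theorem isDyadic_add_iff {u v : UnitAddCircle} (hv : IsDyadic v) :
    IsDyadic (u + v) ↔ IsDyadic u :=
  ⟨fun h => by simpa using h.add hv.neg, fun h => h.add hv⟩

theorem countable_isDyadic : {u : UnitAddCircle | IsDyadic u}.Countable := by
  have : {u : UnitAddCircle | IsDyadic u} ⊆
      range (fun p : ℕ × ℤ => (((p.2 : ℝ) / 2 ^ p.1 : ℝ) : UnitAddCircle)) := by
    rintro u ⟨N, hN⟩
    have h := eq_coe_dyadicIndex_sub hN 0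
    exact ⟨(N, (dyadicIndex N (0 + u) : ℤ) - dyadicIndex N 0), by push_cast; exact h.symm⟩
  exact (countable_range _).mono this

theorem dense_isDyadic : Dense {u : UnitAddCircle | IsDyadic u} := by
  have h : DenseRange ((↑) : ℝ → UnitAddCircle) := QuotientAddGroup.mk_surjective.denseRange
  have hd : Dense (range fun p : ℕ × ℤ => (p.2 : ℝ) / 2 ^ p.1) := by
    refine dense_of_exists_between fun a b hab => ?_
    obtain ⟨n, hn⟩ := exists_pow_lt_of_lt_one (sub_pos.2 hab) (one_half_lt_one (α := ℝ))
    have hp : (0 : ℝ) < 2 ^ n := by positivity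
    rw [div_pow, one_pow, div_lt_iff₀ hp] at hn
    refine ⟨_, ⟨(n, ⌊a * 2 ^ n⌋ + 1), rfl⟩, ?_, ?_⟩
    · rw [lt_div_iff₀ hp]
      push_cast
      exact Int.lt_floor_add_one _
    · rw [div_lt_iff₀ hp]
      push_cast
      have := Int.floor_le (a * 2 ^ n)
      nlinarith
  refine (h.dense_image (AddCircle.continuous_mk' (1 : ℝ)) hd).mono ?_
  rintro _ ⟨_, ⟨p, rfl⟩, rfl⟩
  exact ⟨p.1, two_pow_nsmul_coe_intCast_div p.1 p.2⟩

/-! ### Regular points and dyadic squares of the torus -/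

theorem volume_singleton_circle (u : UnitAddCircle) : volume ({u} : Set UnitAddCircle) = 0 := by
  have := AddCircle.volume_closedBall (T := 1) (x := u) 0
  rw [Metric.closedBall_zero] at this
  rw [this]
  simp

theorem volume_isDyadic : volume {u : UnitAddCircle | IsDyadic u} = 0 := by
  have : NullSingletonClass (volume : Measure UnitAddCircle) := ⟨volume_singleton_circle⟩
  exact countable_isDyadic.measure_zero _

/-- The points of the torus neither of whose coordinates is dyadic. -/
def regularPoints : Set Torus2 := {x | ¬ IsDyadic x.1 ∧ ¬ IsDyadic x.2}

theorem measurableSet_regularPoints : MeasurableSet regularPoints :=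
  (countable_isDyadic.measurableSet.compl.preimage measurable_fst).inter
    (countable_isDyadic.measurableSet.compl.preimage measurable_snd)

theorem ae_mem_regularPoints : ∀ᵐ x : Torus2, x ∈ regularPoints := by
  have h1 : ∀ᵐ x : Torus2, x.1 ∉ {u | IsDyadic u} :=
    Measure.quasiMeasurePreserving_fst.ae (measure_eq_zero_iff_ae_notMem.1 volume_isDyadic)
  have h2 : ∀ᵐ x : Torus2, x.2 ∉ {u | IsDyadic u} :=
    Measure.quasiMeasurePreserving_snd.ae (measure_eq_zero_iff_ae_notMem.1 volume_isDyadic)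
  filter_upwards [h1, h2] with x hx hy using ⟨hx, hy⟩

/-- The pair of dyadic indices of order `N` of the two coordinates. -/
noncomputable def cellOf (N : ℕ) (x : Torus2) : ℕ × ℕ := (dyadicIndex N x.1, dyadicIndex N x.2)

theorem measurable_cellOf (N : ℕ) : Measurable (cellOf N) :=
  ((measurable_dyadicIndex N).comp measurable_fst).prodMk
    ((measurable_dyadicIndex N).comp measurable_snd)

/-- The translation vector from the cell `c` to the cell `d` of order `N`. -/
noncomputable def cellShift (N : ℕ) (c d : ℕ × ℕ) : Torus2 :=
  toTorus2 (((d.1 : ℝ) - c.1) / 2 ^ N, ((d.2 : ℝ) - c.2) / 2 ^ N)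

theorem toTorus2_add (p q : ℝ × ℝ) : toTorus2 (p + q) = toTorus2 p + toTorus2 q := rfl

theorem cellShift_add_cellShift (N : ℕ) (b c d : ℕ × ℕ) :
    cellShift N b c + cellShift N c d = cellShift N b d := by
  rw [cellShift, cellShift, ← toTorus2_add, Prod.mk_add_mk, cellShift]
  congr 2 <;> ring

theorem cellShift_self (N : ℕ) (c : ℕ × ℕ) : cellShift N c c = 0 := by
  simp [cellShift, toTorus2]

theorem cellOf_add_cellShift {N : ℕ} {x : Torus2} {c d : ℕ × ℕ} (h : cellOf N x = c)
    (h1 : d.1 < 2 ^ N) (h2 : d.2 < 2 ^ N) : cellOf N (x + cellShift N c d) = d := by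
  subst h
  exact Prod.ext (dyadicIndex_add rfl h1) (dyadicIndex_add rfl h2)

theorem isDyadic_cellShift (N : ℕ) (c d : ℕ × ℕ) :
    IsDyadic (cellShift N c d).1 ∧ IsDyadic (cellShift N c d).2 :=
  ⟨isDyadic_coe_sub_div _ _ _, isDyadic_coe_sub_div _ _ _⟩

theorem add_mem_regularPoints_iff {x t : Torus2} (h : IsDyadic t.1 ∧ IsDyadic t.2) :
    x + t ∈ regularPoints ↔ x ∈ regularPoints := by
  simp only [regularPoints, mem_ofPred_eq, Prod.fst_add, Prod.snd_add, isDyadic_add_iff h.1,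
    isDyadic_add_iff h.2]

theorem cellOf_lt (N : ℕ) (x : Torus2) : (cellOf N x).1 < 2 ^ N ∧ (cellOf N x).2 < 2 ^ N :=
  ⟨dyadicIndex_lt _ _, dyadicIndex_lt _ _⟩

theorem cellOf_succ_div (N : ℕ) (x : Torus2) :
    (cellOf (N + 1) x).1 / 2 = (cellOf N x).1 ∧ (cellOf (N + 1) x).2 / 2 = (cellOf N x).2 :=
  ⟨dyadicIndex_succ_div _ _, dyadicIndex_succ_div _ _⟩

/-- A non-dyadic point never lies on an endpoint, so the open interval and the half-open one of
`dyadicIndex` contain the same such points. -/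
theorem mem_coe_image_Ioo_iff {N a : ℕ} (ha : a < 2 ^ N) {u : UnitAddCircle} (hu : ¬ IsDyadic u) :
    u ∈ ((↑) : ℝ → UnitAddCircle) '' Ioo ((a : ℝ) / 2 ^ N) (a / 2 ^ N + 1 / 2 ^ N) ↔
      dyadicIndex N u = a := by
  have ha' : ((a : ℝ) + 1) / 2 ^ N ≤ 1 := by
    rw [div_le_one (by positivity)]; exact_mod_cast ha
  have h0 : (0 : ℝ) ≤ a / 2 ^ N := by positivity
  rw [dyadicIndex_eq_iff, ← add_div]
  constructor
  · rintro ⟨s, ⟨h1, h2⟩, rfl⟩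
    rw [circleRep_coe (h0.trans h1.le) (h2.trans_le ha')]
    exact ⟨h1.le, h2⟩
  · rintro ⟨h1, h2⟩
    refine ⟨circleRep u, ⟨lt_of_le_of_ne h1 fun h => hu ?_, h2⟩, coe_circleRep u⟩
    rw [← coe_circleRep u, ← h]
    simpa using isDyadic_coe_sub_div N 0 a

theorem mem_coe_image_Icc_iff {N a : ℕ} (ha : a < 2 ^ N) {u : UnitAddCircle} (hu : ¬ IsDyadic u) :
    u ∈ ((↑) : ℝ → UnitAddCircle) '' Icc ((a : ℝ) / 2 ^ N) (a / 2 ^ N + 1 / 2 ^ N) ↔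
      dyadicIndex N u = a := by
  rw [← mem_coe_image_Ioo_iff ha hu]
  refine ⟨?_, fun h => image_mono Ioo_subset_Icc_self h⟩
  rintro ⟨s, ⟨h1, h2⟩, rfl⟩
  refine ⟨s, ⟨lt_of_le_of_ne h1 fun h => hu ?_, lt_of_le_of_ne h2 fun h => hu ?_⟩, rfl⟩
  · rw [← h]
    simpa using isDyadic_coe_sub_div N 0 a
  · rw [h, ← add_div]
    simpa using isDyadic_coe_sub_div N 0 (a + 1)

theorem notMem_coe_image_Ioo {N : ℕ} (a : ℕ) {u : UnitAddCircle} (hu : (2 ^ N : ℕ) • u = 0) :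
    u ∉ ((↑) : ℝ → UnitAddCircle) '' Ioo ((a : ℝ) / 2 ^ N) (a / 2 ^ N + 1 / 2 ^ N) := by
  rintro ⟨s, ⟨h1, h2⟩, rfl⟩
  rw [← AddCircle.coe_nsmul, AddCircle.coe_eq_zero_iff] at hu
  obtain ⟨m, hm⟩ := hu
  rw [zsmul_one, nsmul_eq_mul] at hm
  push_cast at hm
  rw [div_lt_iff₀' (by positivity)] at h1
  rw [← add_div, lt_div_iff₀' (by positivity)] at h2
  rw [← hm] at h1 h2
  norm_cast at h1 h2
  omega

theorem openSquare_eq (p : ℝ × ℝ) (l : ℝ) : openSquare p l =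
    (((↑) : ℝ → UnitAddCircle) '' Ioo p.1 (p.1 + l)) ×ˢ
      (((↑) : ℝ → UnitAddCircle) '' Ioo p.2 (p.2 + l)) :=
  prodMap_image_prod _ _ _ _

theorem closedSquare_eq (p : ℝ × ℝ) (l : ℝ) : closedSquare p l =
    (((↑) : ℝ → UnitAddCircle) '' Icc p.1 (p.1 + l)) ×ˢ
      (((↑) : ℝ → UnitAddCircle) '' Icc p.2 (p.2 + l)) :=
  prodMap_image_prod _ _ _ _

/-- The lower left corner of the cell `c` of order `N`. -/
noncomputable def cellCorner (N : ℕ) (c : ℕ × ℕ) : ℝ × ℝ := ((c.1 : ℝ) / 2 ^ N, (c.2 : ℝ) / 2 ^ N)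

theorem mem_openSquare_iff {N : ℕ} {c : ℕ × ℕ} (hc : c.1 < 2 ^ N ∧ c.2 < 2 ^ N) {x : Torus2}
    (hx : x ∈ regularPoints) :
    x ∈ openSquare (cellCorner N c) (1 / 2 ^ N) ↔ cellOf N x = c := by
  rw [openSquare_eq, mem_prod, cellCorner, mem_coe_image_Ioo_iff hc.1 hx.1,
    mem_coe_image_Ioo_iff hc.2 hx.2, cellOf, Prod.ext_iff]

theorem mem_closedSquare_iff {N : ℕ} {c : ℕ × ℕ} (hc : c.1 < 2 ^ N ∧ c.2 < 2 ^ N) {x : Torus2}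
    (hx : x ∈ regularPoints) :
    x ∈ closedSquare (cellCorner N c) (1 / 2 ^ N) ↔ cellOf N x = c := by
  rw [closedSquare_eq, mem_prod, cellCorner, mem_coe_image_Icc_iff hc.1 hx.1,
    mem_coe_image_Icc_iff hc.2 hx.2, cellOf, Prod.ext_iff]

/-- A dyadic coordinate of order M lies on the grid lines of every order `N ≥ M`, which open cells
avoid. -/
theorem eventually_notMem_openSquare {x : Torus2} (hx : x ∉ regularPoints) :
    ∀ᶠ N in atTop, ∀ c, x ∉ openSquare (cellCorner N c) (1 / 2 ^ N) := by
  have : IsDyadic x.1 ∨ IsDyadic x.2 := by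
    by_contra! h
    exact hx h
  obtain ⟨M, hM⟩ | ⟨M, hM⟩ := this
  · filter_upwards [eventually_ge_atTop M] with N hN c hc
    rw [openSquare_eq] at hc
    exact notMem_coe_image_Ioo _ (two_pow_nsmul_eq_zero_of_le hN hM) hc.1
  · filter_upwards [eventually_ge_atTop M] with N hN c hc
    rw [openSquare_eq] at hc
    exact notMem_coe_image_Ioo _ (two_pow_nsmul_eq_zero_of_le hN hM) hc.2

theorem isOpen_openSquare (p : ℝ × ℝ) (l : ℝ) : IsOpen (openSquare p l) := by
  rw [openSquare_eq]
  exact (QuotientAddGroup.isOpenMap_coe _ isOpen_Ioo).prod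
    (QuotientAddGroup.isOpenMap_coe _ isOpen_Ioo)

/-! ### The integer coordinates of the levels -/

/-- The `q`-th quarter of a cell of order `N`, as a cell of order `N + 1`. -/
def cellQuarter (c : ℕ × ℕ) : ℕ → ℕ × ℕ
  | 1 => (2 * c.1, 2 * c.2 + 1)
  | 2 => (2 * c.1 + 1, 2 * c.2 + 1)
  | 3 => (2 * c.1, 2 * c.2)
  | _ => (2 * c.1 + 1, 2 * c.2)

/-- The remaining square `R_m` as a cell of order `m`. -/
def remainderCell (m : ℕ) : ℕ × ℕ := (2 ^ m - 1, 0)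

/-- The `j`-th level of the `n`-th column as a cell of order `n - 1`. -/
def levelCell : ℕ → ℕ → ℕ × ℕ
  | 0, _ => (0, 0)
  | 1, _ => (0, 0)
  | n + 2, j =>
      let h := columnHeight (n + 1)
      if j ≤ h then cellQuarter (levelCell (n + 1) j) 1
      else if j ≤ 2 * h then cellQuarter (levelCell (n + 1) (j - h)) 2
      else if j = 2 * h + 1 then cellQuarter (remainderCell n) 1
      else if j ≤ 3 * h + 1 then cellQuarter (levelCell (n + 1) (j - (2 * h + 1))) 3
      else if j = 3 * h + 2 then cellQuarter (remainderCell n) 2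
      else if j ≤ 4 * h + 2 then cellQuarter (levelCell (n + 1) (j - (3 * h + 2))) 4
      else cellQuarter (remainderCell n) 3

theorem levelSide_succ (N : ℕ) : levelSide (N + 1) = 1 / 2 ^ N := by
  rw [levelSide, pow_succ]; field_simp

theorem levelSide_succ_half (N : ℕ) : levelSide (N + 1) / 2 = 1 / 2 ^ (N + 1) := by
  rw [levelSide_succ, pow_succ]; field_simp

theorem quarter_cellCorner (N : ℕ) (c : ℕ × ℕ) (q : ℕ) :
    quarter (cellCorner N c) (levelSide (N + 1)) q = cellCorner (N + 1) (cellQuarter c q) := by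
  rcases q with _ | _ | _ | _ | q <;>
  · simp only [quarter, cellQuarter, cellCorner, levelSide_succ_half]
    push_cast
    ext <;> simp only [pow_succ] <;> field_simp

theorem remainderCorner_eq (m : ℕ) : remainderCorner m = cellCorner m (remainderCell m) := by
  have : 1 ≤ 2 ^ m := Nat.one_le_two_pow
  simp only [remainderCorner, cellCorner, remainderCell, levelSide_succ]
  push_cast [this]
  ext
  · simp only; field_simp
  · simp

theorem levelCorner_eq (N j : ℕ) : levelCorner (N + 1) j = cellCorner N (levelCell (N + 1) j) := by
  induction N generalizing j with
  | zero => simp [levelCorner, levelCell, cellCorner]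
  | succ N ih =>
    simp only [levelCorner, levelCell, ih, remainderCorner_eq, quarter_cellCorner]
    split_ifs <;> rfl

theorem cellQuarter_lt {N : ℕ} {c : ℕ × ℕ} (hc : c.1 < 2 ^ N ∧ c.2 < 2 ^ N) (q : ℕ) :
    (cellQuarter c q).1 < 2 ^ (N + 1) ∧ (cellQuarter c q).2 < 2 ^ (N + 1) := by
  rw [pow_succ]
  rcases q with _ | _ | _ | _ | q <;> (simp only [cellQuarter]; omega)

theorem remainderCell_lt (m : ℕ) : (remainderCell m).1 < 2 ^ m ∧ (remainderCell m).2 < 2 ^ m := by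
  have : 1 ≤ 2 ^ m := Nat.one_le_two_pow
  simp only [remainderCell]
  omega

theorem levelCell_lt (N j : ℕ) :
    (levelCell (N + 1) j).1 < 2 ^ N ∧ (levelCell (N + 1) j).2 < 2 ^ N := by
  induction N generalizing j with
  | zero => simp [levelCell]
  | succ N ih =>
    simp only [levelCell]
    split_ifs <;>
      first | exact cellQuarter_lt (ih _) _ | exact cellQuarter_lt (remainderCell_lt _) _

theorem columnHeight_succ_succ (n : ℕ) : columnHeight (n + 2) = 4 * columnHeight (n + 1) + 3 := rfl

theorem columnHeight_add_one (n : ℕ) : columnHeight (n + 1) + 1 = 4 ^ n := by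
  induction n with
  | zero => rfl
  | succ n ih => rw [columnHeight_succ_succ, pow_succ]; omega

section

variable (n : ℕ)

theorem levelCell_quarter_one {j : ℕ} (hj : j ≤ columnHeight (n + 1)) :
    levelCell (n + 2) j = cellQuarter (levelCell (n + 1) j) 1 := by
  simp only [levelCell]; rw [if_pos hj]

theorem levelCell_quarter_two {j : ℕ} (hj : j ≤ columnHeight (n + 1)) (h1 : 1 ≤ j) :
    levelCell (n + 2) (columnHeight (n + 1) + j) = cellQuarter (levelCell (n + 1) j) 2 := by
  simp only [levelCell]
  rw [if_neg (by omega), if_pos (by omega), Nat.add_sub_cancel_left]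

theorem levelCell_remainder_one :
    levelCell (n + 2) (2 * columnHeight (n + 1) + 1) = cellQuarter (remainderCell n) 1 := by
  simp only [levelCell]
  rw [if_neg (by omega), if_neg (by omega), if_pos trivial]

theorem levelCell_quarter_three {j : ℕ} (hj : j ≤ columnHeight (n + 1)) (h1 : 1 ≤ j) :
    levelCell (n + 2) (2 * columnHeight (n + 1) + 1 + j) = cellQuarter (levelCell (n + 1) j) 3 := by
  simp only [levelCell]
  rw [if_neg (by omega), if_neg (by omega), if_neg (by omega), if_pos (by omega),
    Nat.add_sub_cancel_left]

theorem levelCell_remainder_two :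
    levelCell (n + 2) (3 * columnHeight (n + 1) + 2) = cellQuarter (remainderCell n) 2 := by
  simp only [levelCell]
  rw [if_neg (by omega), if_neg (by omega), if_neg (by omega), if_neg (by omega), if_pos trivial]

theorem levelCell_quarter_four {j : ℕ} (hj : j ≤ columnHeight (n + 1)) (h1 : 1 ≤ j) :
    levelCell (n + 2) (3 * columnHeight (n + 1) + 2 + j) = cellQuarter (levelCell (n + 1) j) 4 := by
  simp only [levelCell]
  rw [if_neg (by omega), if_neg (by omega), if_neg (by omega), if_neg (by omega),
    if_neg (by omega), if_pos (by omega), Nat.add_sub_cancel_left]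

theorem levelCell_remainder_three :
    levelCell (n + 2) (4 * columnHeight (n + 1) + 3) = cellQuarter (remainderCell n) 3 := by
  simp only [levelCell]
  rw [if_neg (by omega), if_neg (by omega), if_neg (by omega), if_neg (by omega),
    if_neg (by omega), if_neg (by omega)]

theorem remainderCell_succ : remainderCell (n + 1) = cellQuarter (remainderCell n) 4 := by
  have : 1 ≤ 2 ^ n := Nat.one_le_two_pow
  simp only [remainderCell, cellQuarter, pow_succ]
  exact Prod.ext (by simp only; omega) rfl

theorem levelCell_last :
    levelCell (n + 2) (columnHeight (n + 2)) = cellQuarter (remainderCell n) 3 :=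
  levelCell_remainder_three n

theorem levelCell_one : levelCell (n + 2) 1 = (0, 2 ^ (n + 1) - 1) := by
  induction n with
  | zero => exact levelCell_remainder_one 0
  | succ n ih =>
    rw [levelCell_quarter_one (n + 1) (by rw [columnHeight_succ_succ]; omega), ih]
    have : 1 ≤ 2 ^ (n + 1) := Nat.one_le_two_pow
    simp only [cellQuarter, pow_succ _ (n + 1)]
    exact Prod.ext rfl (by simp only; omega)

end

/-! ### Quarters of cells and the enumeration of the grid by a column. -/

theorem exists_cellQuarter {c d : ℕ × ℕ} (h1 : d.1 / 2 = c.1) (h2 : d.2 / 2 = c.2) :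
    ∃ q, 1 ≤ q ∧ q ≤ 4 ∧ d = cellQuarter c q := by
  rcases Nat.mod_two_eq_zero_or_one d.1 with e1 | e1 <;>
    rcases Nat.mod_two_eq_zero_or_one d.2 with e2 | e2
  · exact ⟨3, by omega, by omega, Prod.ext (by simp only [cellQuarter]; omega)
      (by simp only [cellQuarter]; omega)⟩
  · exact ⟨1, by omega, by omega, Prod.ext (by simp only [cellQuarter]; omega)
      (by simp only [cellQuarter]; omega)⟩
  · exact ⟨4, by omega, by omega, Prod.ext (by simp only [cellQuarter]; omega)
      (by simp only [cellQuarter]; omega)⟩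
  · exact ⟨2, by omega, by omega, Prod.ext (by simp only [cellQuarter]; omega)
      (by simp only [cellQuarter]; omega)⟩

theorem cellQuarter_div (c : ℕ × ℕ) (q : ℕ) :
    (cellQuarter c q).1 / 2 = c.1 ∧ (cellQuarter c q).2 / 2 = c.2 := by
  rcases q with _ | _ | _ | _ | q <;> (simp only [cellQuarter]; omega)

/-- The bounds matter: `cellQuarter` sends 0 and every index above 4 to the fourth quarter as well.
-/
theorem cellQuarter_inj {c d : ℕ × ℕ} {p q : ℕ} (hp : 1 ≤ p ∧ p ≤ 4) (hq : 1 ≤ q ∧ q ≤ 4) :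
    cellQuarter c p = cellQuarter d q ↔ c = d ∧ p = q := by
  refine ⟨fun h => ?_, by rintro ⟨rfl, rfl⟩; rfl⟩
  have hc := cellQuarter_div c p
  have hd := cellQuarter_div d q
  refine ⟨Prod.ext (by rw [← hc.1, h, hd.1]) (by rw [← hc.2, h, hd.2]), ?_⟩
  obtain ⟨hp1, hp2⟩ := hp
  obtain ⟨hq1, hq2⟩ := hq
  interval_cases p <;> interval_cases q <;> simp [cellQuarter, Prod.ext_iff] at h ⊢; all_goals omega

/-- The parent cell is either a level, all of whose quarters are stacked, or the remaining square,
whose first three quarters are spacers and whose fourth is the new remaining square. -/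
theorem exists_levelCell_eq (N : ℕ) {c : ℕ × ℕ} (hc : c.1 < 2 ^ N ∧ c.2 < 2 ^ N)
    (hr : c ≠ remainderCell N) :
    ∃ i, 1 ≤ i ∧ i ≤ columnHeight (N + 1) ∧ levelCell (N + 1) i = c := by
  induction N generalizing c with
  | zero =>
    exact absurd (Prod.ext (by simp [remainderCell]; omega) (by simp [remainderCell]; omega)) hr
  | succ N ih =>
    have hd : c.1 / 2 < 2 ^ N ∧ c.2 / 2 < 2 ^ N := by rw [pow_succ] at hc; omega
    obtain ⟨q, hq1, hq4, hq⟩ := exists_cellQuarter (c := (c.1 / 2, c.2 / 2)) (d := c) rfl rfl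
    rw [columnHeight_succ_succ]
    by_cases hrem : (c.1 / 2, c.2 / 2) = remainderCell N
    · rw [hrem] at hq
      interval_cases q
      · exact ⟨_, by omega, by omega, (levelCell_remainder_one N).trans hq.symm⟩
      · exact ⟨_, by omega, by omega, (levelCell_remainder_two N).trans hq.symm⟩
      · exact ⟨_, by omega, by omega, (levelCell_remainder_three N).trans hq.symm⟩
      · exact absurd (hq.trans (remainderCell_succ N).symm) hr
    · obtain ⟨i, h1, h2, h3⟩ := ih hd hrem
      rw [← h3] at hq
      interval_cases q
      · exact ⟨_, by omega, by omega, (levelCell_quarter_one N h2).trans hq.symm⟩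
      · exact ⟨_, by omega, by omega, (levelCell_quarter_two N h2 h1).trans hq.symm⟩
      · exact ⟨_, by omega, by omega, (levelCell_quarter_three N h2 h1).trans hq.symm⟩
      · exact ⟨_, by omega, by omega, (levelCell_quarter_four N h2 h1).trans hq.symm⟩

/-- Injectivity comes by counting: `4 ^ N - 1` indices hit all of the `4 ^ N - 1` cells other than
the remaining one. -/
theorem levelCell_injOn_and_image (N : ℕ) :
    InjOn (levelCell (N + 1)) (Finset.Icc 1 (columnHeight (N + 1)) : Set ℕ) ∧
      (Finset.Icc 1 (columnHeight (N + 1))).image (levelCell (N + 1)) =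
        (Finset.range (2 ^ N) ×ˢ Finset.range (2 ^ N)).erase (remainderCell N) := by
  set I := Finset.Icc 1 (columnHeight (N + 1))
  set C := (Finset.range (2 ^ N) ×ˢ Finset.range (2 ^ N)).erase (remainderCell N)
  have hcard : I.card = C.card := by
    rw [Nat.card_Icc, Finset.card_erase_of_mem, Finset.card_product, Finset.card_range,
      Nat.add_sub_cancel, ← mul_pow]
    · have := columnHeight_add_one N
      norm_num
      omega
    · rw [Finset.mem_product, Finset.mem_range, Finset.mem_range]
      exact remainderCell_lt N
  have hsub : C ⊆ I.image (levelCell (N + 1)) := fun c hc => by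
    rw [Finset.mem_erase, Finset.mem_product, Finset.mem_range, Finset.mem_range] at hc
    obtain ⟨i, h1, h2, h3⟩ := exists_levelCell_eq N hc.2 hc.1
    exact Finset.mem_image.2 ⟨i, Finset.mem_Icc.2 ⟨h1, h2⟩, h3⟩
  have heq := Finset.eq_of_subset_of_card_le hsub (Finset.card_image_le.trans hcard.le)
  exact ⟨Finset.card_image_iff.1 (by rw [← heq, hcard]), heq.symm⟩

theorem levelCell_inj {N i j : ℕ} (hi : 1 ≤ i ∧ i ≤ columnHeight (N + 1))
    (hj : 1 ≤ j ∧ j ≤ columnHeight (N + 1)) (h : levelCell (N + 1) i = levelCell (N + 1) j) :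
    i = j :=
  (levelCell_injOn_and_image N).1 (by simpa using hi) (by simpa using hj) h

theorem levelCell_ne_remainderCell {N i : ℕ} (hi : 1 ≤ i ∧ i ≤ columnHeight (N + 1)) :
    levelCell (N + 1) i ≠ remainderCell N := by
  have := Finset.mem_image_of_mem (levelCell (N + 1)) (Finset.mem_Icc.2 hi)
  rw [(levelCell_injOn_and_image N).2] at this
  exact (Finset.mem_erase.1 this).1

/-! ### The maps on regular points -/

theorem mem_openLevel_iff {N i : ℕ} {x : Torus2} (hx : x ∈ regularPoints) :
    x ∈ openLevel (N + 1) i ↔ cellOf N x = levelCell (N + 1) i := by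
  rw [openLevel, levelCorner_eq, levelSide_succ, mem_openSquare_iff (levelCell_lt N i) hx]

theorem mem_level_iff {N i : ℕ} {x : Torus2} (hx : x ∈ regularPoints) :
    x ∈ level (N + 1) i ↔ cellOf N x = levelCell (N + 1) i := by
  rw [level, levelCorner_eq, levelSide_succ, mem_closedSquare_iff (levelCell_lt N i) hx]

theorem lastQuarter_eq (N q : ℕ) : lastQuarter (N + 1) q =
    openSquare (cellCorner (N + 1)
      (cellQuarter (levelCell (N + 1) (columnHeight (N + 1))) q)) (1 / 2 ^ (N + 1)) := by
  rw [lastQuarter, levelCorner_eq, quarter_cellCorner, levelSide_succ_half]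

theorem remainderQuarter_eq (m q : ℕ) : remainderQuarter m q =
    openSquare (cellCorner (m + 1) (cellQuarter (remainderCell m) q)) (1 / 2 ^ (m + 1)) := by
  rw [remainderQuarter, remainderCorner_eq, quarter_cellCorner, levelSide_succ_half]

theorem mem_lastQuarter_iff {N q : ℕ} {x : Torus2} (hx : x ∈ regularPoints) :
    x ∈ lastQuarter (N + 1) q ↔
      cellOf (N + 1) x = cellQuarter (levelCell (N + 1) (columnHeight (N + 1))) q := by
  rw [lastQuarter_eq, mem_openSquare_iff (cellQuarter_lt (levelCell_lt N _) q) hx]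

theorem mem_remainderQuarter_iff {m q : ℕ} {x : Torus2} (hx : x ∈ regularPoints) :
    x ∈ remainderQuarter m q ↔ cellOf (m + 1) x = cellQuarter (remainderCell m) q := by
  rw [remainderQuarter_eq, mem_openSquare_iff (cellQuarter_lt (remainderCell_lt m) q) hx]

/-- Climbing between equal quarters of two levels is the same translation as climbing between the
levels; this makes successive columns compatible. -/
theorem cellShift_cellQuarter (N : ℕ) (c d : ℕ × ℕ) (q : ℕ) :
    cellShift (N + 1) (cellQuarter c q) (cellQuarter d q) = cellShift N c d := by
  rcases q with _ | _ | _ | _ | q <;>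
  · simp only [cellShift, cellQuarter, pow_succ]
    push_cast
    congr 2 <;> field_simp <;> ring

theorem cellOf_eq_of_succ {N : ℕ} {x : Torus2} {c : ℕ × ℕ} {q : ℕ}
    (h : cellOf (N + 1) x = cellQuarter c q) : cellOf N x = c := by
  have h1 := cellOf_succ_div N x
  have h2 := cellQuarter_div c q
  rw [h, h2.1, h2.2] at h1
  exact Prod.ext h1.1.symm h1.2.symm

theorem columnHeight_pos (n : ℕ) : 0 < columnHeight (n + 2) := by
  rw [columnHeight_succ_succ]; omega

section ShiftValues

variable (n : ℕ)

theorem cellShift_last_one :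
    cellShift (n + 2) (cellQuarter (levelCell (n + 2) (columnHeight (n + 2))) 1)
      (cellQuarter (levelCell (n + 2) 1) 2) =
      toTorus2 (5 / 2 ^ (n + 2) - 1, 1 - 1 / 2 ^ (n + 1)) := by
  rw [levelCell_last, levelCell_one]
  simp only [cellShift, cellQuarter, remainderCell]
  push_cast [Nat.one_le_two_pow]
  congr 2 <;> field_simp <;> ring

theorem cellShift_last_two :
    cellShift (n + 2) (cellQuarter (levelCell (n + 2) (columnHeight (n + 2))) 2)
      (cellQuarter (remainderCell (n + 1)) 1) = toTorus2 (1 / 2 ^ (n + 2), 0) := by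
  rw [levelCell_last, remainderCell_succ]
  simp only [cellShift, cellQuarter, remainderCell]
  push_cast [Nat.one_le_two_pow]
  congr 2 <;> field_simp <;> ring

theorem cellShift_last_three :
    cellShift (n + 2) (cellQuarter (levelCell (n + 2) (columnHeight (n + 2))) 3)
      (cellQuarter (remainderCell (n + 1)) 2) =
      toTorus2 (3 / 2 ^ (n + 2), 1 / 2 ^ (n + 2)) := by
  rw [levelCell_last, remainderCell_succ]
  simp only [cellShift, cellQuarter, remainderCell]
  push_cast [Nat.one_le_two_pow]
  congr 2 <;> field_simp <;> ring

theorem cellShift_last_four :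
    cellShift (n + 2) (cellQuarter (levelCell (n + 2) (columnHeight (n + 2))) 4)
      (cellQuarter (remainderCell (n + 1)) 3) = toTorus2 (1 / 2 ^ (n + 2), 0) := by
  rw [levelCell_last, remainderCell_succ]
  simp only [cellShift, cellQuarter, remainderCell]
  push_cast [Nat.one_le_two_pow]
  congr 2 <;> field_simp <;> ring

theorem cellShift_remainder_one :
    cellShift (n + 2) (cellQuarter (remainderCell (n + 1)) 1)
      (cellQuarter (levelCell (n + 2) 1) 3) =
      toTorus2 (1 / 2 ^ (n + 1) - 1, (2 ^ (n + 2) - 3) / 2 ^ (n + 2)) := by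
  rw [levelCell_one]
  simp only [cellShift, cellQuarter, remainderCell]
  push_cast [Nat.one_le_two_pow]
  congr 2 <;> field_simp <;> ring

theorem cellShift_remainder_two :
    cellShift (n + 2) (cellQuarter (remainderCell (n + 1)) 2)
      (cellQuarter (levelCell (n + 2) 1) 4) =
      toTorus2 (1 / 2 ^ (n + 1) - 1, (2 ^ (n + 2) - 3) / 2 ^ (n + 2)) := by
  rw [levelCell_one]
  simp only [cellShift, cellQuarter, remainderCell]
  push_cast [Nat.one_le_two_pow]
  congr 2 <;> field_simp <;> ring

end ShiftValues

/-- Inside the levels `Q_{n+1,1}, …, Q_{n+1,h-1}` the map `U_n` climbs the column. -/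
theorem chaconStep_eq_add_cellShift (n : ℕ) {x : Torus2} (hx : x ∈ regularPoints) {i : ℕ}
    (h1 : 1 ≤ i) (hi : i < columnHeight (n + 2)) (hc : cellOf (n + 1) x = levelCell (n + 2) i) :
    chaconStep (n + 1) x =
      x + cellShift (n + 1) (levelCell (n + 2) i) (levelCell (n + 2) (i + 1)) := by
  induction n generalizing i with
  | zero =>
    have hi' : i < 3 := hi
    have e1 : levelCell 2 1 = cellQuarter (remainderCell 0) 1 := levelCell_remainder_one 0
    have e2 : levelCell 2 2 = cellQuarter (remainderCell 0) 2 := levelCell_remainder_two 0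
    have e3 : levelCell 2 3 = cellQuarter (remainderCell 0) 3 := levelCell_remainder_three 0
    simp only [zero_add] at hc ⊢
    rw [chaconStep, mem_remainderQuarter_iff hx, mem_remainderQuarter_iff hx, zero_add, hc]
    interval_cases i
    · rw [e1, e2, if_pos rfl]
      simp [cellShift, cellQuarter, remainderCell]
    · rw [e2, e3, if_neg (by simp [cellQuarter_inj]), if_pos rfl]
      simp [cellShift, cellQuarter, remainderCell]
  | succ n ih =>
    set h := columnHeight (n + 2) with hh
    have hpos : 0 < h := columnHeight_pos n
    -- Below the top of the old column the first branch of the definition hands over to the previous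
    -- map, and the induction hypothesis applies to the parent cell.
    have hclimb : ∀ k q, 1 ≤ k → k < h →
        cellOf (n + 2) x = cellQuarter (levelCell (n + 2) k) q →
        chaconStep (n + 2) x = x + cellShift (n + 2) (cellQuarter (levelCell (n + 2) k) q)
          (cellQuarter (levelCell (n + 2) (k + 1)) q) := by
      intro k q hk1 hk hcell
      have hp := cellOf_eq_of_succ hcell
      rw [chaconStep, if_pos ⟨k, hk1, hk, (mem_openLevel_iff hx).2 hp⟩, cellShift_cellQuarter]
      exact ih hk1 hk hp
    have hlast : ∀ q, cellOf (n + 2) x = cellQuarter (levelCell (n + 2) h) q →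
        ¬ ∃ i, 1 ≤ i ∧ i < columnHeight (n + 2) ∧ x ∈ openLevel (n + 2) i := by
      rintro q hcell ⟨k, hk1, hk, hmem⟩
      rw [mem_openLevel_iff hx, cellOf_eq_of_succ hcell] at hmem
      have := levelCell_inj ⟨hpos, le_rfl⟩ ⟨hk1, hk.le⟩ hmem
      omega
    have hrem : ∀ q, cellOf (n + 2) x = cellQuarter (remainderCell (n + 1)) q →
        ¬ ∃ i, 1 ≤ i ∧ i < columnHeight (n + 2) ∧ x ∈ openLevel (n + 2) i := by
      rintro q hcell ⟨k, hk1, hk, hmem⟩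
      rw [mem_openLevel_iff hx, cellOf_eq_of_succ hcell] at hmem
      exact levelCell_ne_remainderCell ⟨hk1, hk.le⟩ hmem.symm
    have hne : remainderCell (n + 1) ≠ levelCell (n + 1 + 1) (columnHeight (n + 1 + 1)) :=
      (levelCell_ne_remainderCell ⟨hpos, le_rfl⟩).symm
    have hi3 : i < 4 * h + 3 := hi
    -- Position in the new column: one of four copies of the old one, or the spacer 1 or 2. The
    -- third spacer is the top, excluded by `hi3`. Within a copy only `k = h` needs the new
    -- branches.
    have cases_i : (i ≤ h) ∨ (∃ k, 1 ≤ k ∧ k ≤ h ∧ i = h + k) ∨ i = 2 * h + 1 ∨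
        (∃ k, 1 ≤ k ∧ k ≤ h ∧ i = 2 * h + 1 + k) ∨ i = 3 * h + 2 ∨
        (∃ k, 1 ≤ k ∧ k ≤ h ∧ i = 3 * h + 2 + k) := by
      by_cases c1 : i ≤ h
      · exact .inl c1
      by_cases c2 : i ≤ 2 * h
      · exact .inr (.inl ⟨i - h, by omega, by omega, by omega⟩)
      by_cases c3 : i = 2 * h + 1
      · exact .inr (.inr (.inl c3))
      by_cases c4 : i ≤ 3 * h + 1
      · exact .inr (.inr (.inr (.inl ⟨i - (2 * h + 1), by omega, by omega, by omega⟩)))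
      by_cases c5 : i = 3 * h + 2
      · exact .inr (.inr (.inr (.inr (.inl c5))))
      · exact .inr (.inr (.inr (.inr (.inr ⟨i - (3 * h + 2), by omega, by omega, by omega⟩))))
    rcases cases_i with hk | ⟨k, hk1, hk, rfl⟩ | rfl | ⟨k, hk1, hk, rfl⟩ | rfl | ⟨k, hk1, hk, rfl⟩
    · rw [levelCell_quarter_one (n + 1) hk] at hc ⊢
      rcases hk.lt_or_eq with hlt | rfl
      · rw [levelCell_quarter_one (n + 1) (j := i + 1) hlt]
        exact hclimb i 1 h1 hlt hc
      · rw [levelCell_quarter_two (n + 1) (j := 1) hpos le_rfl, cellShift_last_one, chaconStep,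
          if_neg (hlast 1 hc), if_pos ((mem_lastQuarter_iff hx).2 hc)]
    · rw [levelCell_quarter_two (n + 1) hk hk1] at hc ⊢
      rcases hk.lt_or_eq with hlt | rfl
      · rw [add_assoc h k 1, levelCell_quarter_two (n + 1) (j := k + 1) hlt (by omega)]
        exact hclimb k 2 hk1 hlt hc
      · rw [← two_mul, levelCell_remainder_one (n + 1), cellShift_last_two, chaconStep,
          if_neg (hlast 2 hc)]
        simp only [mem_lastQuarter_iff hx, hc]
        rw [if_neg (by simp [cellQuarter_inj]), if_pos rfl]
    · rw [levelCell_remainder_one (n + 1)] at hc ⊢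
      rw [levelCell_quarter_three (n + 1) (j := 1) hpos le_rfl, cellShift_remainder_one, chaconStep,
        if_neg (hrem 1 hc)]
      simp only [mem_lastQuarter_iff hx, mem_remainderQuarter_iff hx, hc]
      simp [cellQuarter_inj, hne]
    · rw [levelCell_quarter_three (n + 1) hk hk1] at hc ⊢
      rcases hk.lt_or_eq with hlt | rfl
      · rw [add_assoc _ k 1, levelCell_quarter_three (n + 1) (j := k + 1) hlt (by omega)]
        exact hclimb k 3 hk1 hlt hc
      · rw [show 2 * h + 1 + h + 1 = 3 * h + 2 by omega, levelCell_remainder_two (n + 1),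
          cellShift_last_three, chaconStep, if_neg (hlast 3 hc)]
        simp only [mem_lastQuarter_iff hx, hc]
        rw [if_neg (by simp [cellQuarter_inj]), if_neg (by simp [cellQuarter_inj]), if_pos rfl]
    · rw [levelCell_remainder_two (n + 1)] at hc ⊢
      rw [levelCell_quarter_four (n + 1) (j := 1) hpos le_rfl, cellShift_remainder_two, chaconStep,
        if_neg (hrem 2 hc)]
      simp only [mem_lastQuarter_iff hx, mem_remainderQuarter_iff hx, hc]
      simp [cellQuarter_inj, hne]
    · rw [levelCell_quarter_four (n + 1) hk hk1] at hc ⊢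
      rcases hk.lt_or_eq with hlt | rfl
      · rw [add_assoc _ k 1, levelCell_quarter_four (n + 1) (j := k + 1) hlt (by omega)]
        exact hclimb k 4 hk1 hlt hc
      · rw [show 3 * h + 2 + h + 1 = 4 * h + 3 by omega, levelCell_remainder_three (n + 1),
          cellShift_last_four, chaconStep, if_neg (hlast 4 hc)]
        simp only [mem_lastQuarter_iff hx, hc]
        rw [if_neg (by simp [cellQuarter_inj]), if_neg (by simp [cellQuarter_inj]),
          if_neg (by simp [cellQuarter_inj]), if_pos rfl]

/-! ### Stabilisation of `U_n` and the pointwise limit. -/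

theorem exists_levelCell_succ {N i : ℕ} (hi : 1 ≤ i ∧ i ≤ columnHeight (N + 1)) {x : Torus2}
    (hc : cellOf N x = levelCell (N + 1) i) :
    ∃ j, 1 ≤ j ∧ j < columnHeight (N + 2) ∧ cellOf (N + 1) x = levelCell (N + 2) j := by
  obtain ⟨q, hq1, hq4, hq⟩ := exists_cellQuarter (cellOf_succ_div N x).1 (cellOf_succ_div N x).2
  rw [hc] at hq
  rw [columnHeight_succ_succ]
  interval_cases q
  · exact ⟨_, by omega, by omega, hq.trans (levelCell_quarter_one N hi.2).symm⟩
  · exact ⟨_, by omega, by omega, hq.trans (levelCell_quarter_two N hi.2 hi.1).symm⟩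
  · exact ⟨_, by omega, by omega, hq.trans (levelCell_quarter_three N hi.2 hi.1).symm⟩
  · exact ⟨_, by omega, by omega, hq.trans (levelCell_quarter_four N hi.2 hi.1).symm⟩

/-- The top of each later column is a spacer, so a point of a level is never in the top of a later
column and every later map uses its first branch. -/
theorem chaconStep_stable {n i : ℕ} {x : Torus2} (hx : x ∈ regularPoints)
    (h1 : 1 ≤ i) (hi : i < columnHeight (n + 2)) (hc : cellOf (n + 1) x = levelCell (n + 2) i)
    (k : ℕ) : chaconStep (n + 1 + k) x = chaconStep (n + 1) x ∧
      ∃ j, 1 ≤ j ∧ j < columnHeight (n + 2 + k) ∧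
        cellOf (n + 1 + k) x = levelCell (n + 2 + k) j := by
  induction k with
  | zero => exact ⟨rfl, i, h1, hi, hc⟩
  | succ k ih =>
    obtain ⟨e, j, hj1, hj, hjc⟩ := ih
    have e1 : n + 1 + (k + 1) = n + k + 2 := by omega
    have e2 : n + 1 + k = n + k + 1 := by omega
    have e3 : n + 2 + k = n + k + 2 := by omega
    have e4 : n + 2 + (k + 1) = n + k + 3 := by omega
    rw [e2] at e
    rw [e2, e3] at hjc
    rw [e3] at hj
    rw [e1, e4]
    refine ⟨?_, exists_levelCell_succ ⟨hj1, hj.le⟩ hjc⟩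
    rw [chaconStep, if_pos ⟨j, hj1, hj, (mem_openLevel_iff hx).2 hjc⟩, e]

theorem eventually_chaconStep_eq {N i : ℕ} {x : Torus2} (hx : x ∈ regularPoints)
    (h1 : 1 ≤ i) (hi : i < columnHeight (N + 1)) (hc : cellOf N x = levelCell (N + 1) i) :
    ∀ᶠ m in atTop, chaconStep m x =
      x + cellShift N (levelCell (N + 1) i) (levelCell (N + 1) (i + 1)) := by
  rcases N with _ | n
  · exact absurd hi (by simp [columnHeight])
  · filter_upwards [eventually_ge_atTop (n + 1)] with m hm
    obtain ⟨k, rfl⟩ := Nat.exists_eq_add_of_le hm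
    rw [(chaconStep_stable hx h1 hi hc k).1, chaconStep_eq_add_cellShift n hx h1 hi hc]

/-- Every regular point is eventually in an intermediate level of the column. -/
theorem eventually_exists_level (x : Torus2) :
    ∀ᶠ N in atTop, ∃ i, 1 < i ∧ i < columnHeight (N + 1) ∧ cellOf N x = levelCell (N + 1) i := by
  filter_upwards [eventually_dyadicIndex_add_two_lt x.1, eventually_dyadicIndex_add_two_lt x.2,
    eventually_ge_atTop 1] with N hN1 hN2 hN
  have hr : cellOf N x ≠ remainderCell N := by
    intro h
    have := congrArg Prod.fst h
    simp only [cellOf, remainderCell] at this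
    omega
  obtain ⟨i, h1, h2, h3⟩ := exists_levelCell_eq N (cellOf_lt N x) hr
  obtain ⟨n, rfl⟩ := Nat.exists_eq_add_of_le' hN
  refine ⟨i, lt_of_le_of_ne h1 ?_, lt_of_le_of_ne h2 ?_, h3.symm⟩
  · rintro rfl
    rw [levelCell_one] at h3
    have := congrArg Prod.snd h3
    simp only [cellOf] at this
    omega
  · rintro rfl
    rw [levelCell_last] at h3
    have := congrArg Prod.fst h3
    simp only [cellOf, cellQuarter, remainderCell] at this
    rw [pow_succ] at hN1
    omega

theorem eventually_chaconStep_eq_self {x : Torus2} (hx : x ∉ regularPoints) :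
    ∀ᶠ n in atTop, chaconStep n x = x := by
  have h := eventually_notMem_openSquare hx
  rw [← map_add_atTop_eq_nat 2, eventually_map]
  filter_upwards [(tendsto_add_atTop_nat 2).eventually h,
    (tendsto_add_atTop_nat 1).eventually h] with n h2 h1
  have a : ¬ ∃ i, 1 ≤ i ∧ i < columnHeight (n + 2) ∧ x ∈ openLevel (n + 2) i := by
    rintro ⟨i, -, -, hi⟩
    rw [openLevel, levelCorner_eq, levelSide_succ] at hi
    exact h1 _ hi
  have b : ∀ q, x ∉ lastQuarter (n + 2) q := fun q hq => h2 _ (lastQuarter_eq (n + 1) q ▸ hq)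
  have c : ∀ q, x ∉ remainderQuarter (n + 1) q := fun q hq =>
    h2 _ (remainderQuarter_eq (n + 1) q ▸ hq)
  rw [chaconStep]
  simp [a, b, c]

theorem chaconMap_eq_of_eventually {x y : Torus2} (h : ∀ᶠ n in atTop, chaconStep n x = y) :
    chaconMap x = y :=
  (tendsto_nhds_of_eventually_eq h).limUnder_eq

theorem chaconMap_of_notMem {x : Torus2} (hx : x ∉ regularPoints) : chaconMap x = x :=
  chaconMap_eq_of_eventually (eventually_chaconStep_eq_self hx)

theorem chaconMap_eq_add_cellShift {N i : ℕ} {x : Torus2} (hx : x ∈ regularPoints)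
    (h1 : 1 ≤ i) (hi : i < columnHeight (N + 1)) (hc : cellOf N x = levelCell (N + 1) i) :
    chaconMap x = x + cellShift N (levelCell (N + 1) i) (levelCell (N + 1) (i + 1)) :=
  chaconMap_eq_of_eventually (eventually_chaconStep_eq hx h1 hi hc)

theorem eventually_chaconStep_eq_chaconMap (x : Torus2) :
    ∀ᶠ n in atTop, chaconStep n x = chaconMap x := by
  by_cases hx : x ∈ regularPoints
  · obtain ⟨N, i, h1, hi, hc⟩ := (eventually_exists_level x).exists
    rw [chaconMap_eq_add_cellShift hx h1.le hi hc]
    exact eventually_chaconStep_eq hx h1.le hi hc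
  · rw [chaconMap_of_notMem hx]
    exact eventually_chaconStep_eq_self hx

theorem tendsto_chaconStep (x : Torus2) :
    Tendsto (fun n => chaconStep n x) atTop (𝓝 (chaconMap x)) :=
  tendsto_nhds_of_eventually_eq (eventually_chaconStep_eq_chaconMap x)

/-! ### `U` is an automorphism -/

theorem chaconMap_mem_regularPoints_iff {x : Torus2} :
    chaconMap x ∈ regularPoints ↔ x ∈ regularPoints := by
  by_cases hx : x ∈ regularPoints
  · obtain ⟨N, i, h1, hi, hc⟩ := (eventually_exists_level x).exists
    rw [chaconMap_eq_add_cellShift hx h1.le hi hc,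
      add_mem_regularPoints_iff (isDyadic_cellShift _ _ _)]
  · rw [chaconMap_of_notMem hx]

theorem cellOf_chaconMap {N i : ℕ} {x : Torus2} (hx : x ∈ regularPoints)
    (h1 : 1 ≤ i) (hi : i < columnHeight (N + 1)) (hc : cellOf N x = levelCell (N + 1) i) :
    cellOf N (chaconMap x) = levelCell (N + 1) (i + 1) := by
  rw [chaconMap_eq_add_cellShift hx h1 hi hc]
  exact cellOf_add_cellShift hc (levelCell_lt _ _).1 (levelCell_lt _ _).2

theorem chaconMap_iterate {N i k : ℕ} {x : Torus2} (hx : x ∈ regularPoints)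
    (h1 : 1 ≤ i) (hi : i + k ≤ columnHeight (N + 1)) (hc : cellOf N x = levelCell (N + 1) i) :
    chaconMap^[k] x = x + cellShift N (levelCell (N + 1) i) (levelCell (N + 1) (i + k)) := by
  induction k generalizing x i with
  | zero => simp [cellShift_self]
  | succ k ih =>
    rw [Function.iterate_succ_apply,
      ih (chaconMap_mem_regularPoints_iff.2 hx) (i := i + 1) (by omega) (by omega)
        (cellOf_chaconMap hx h1 (by omega) hc),
      chaconMap_eq_add_cellShift hx h1 (by omega) hc, add_assoc, cellShift_add_cellShift,
      show i + 1 + k = i + (k + 1) by omega]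

theorem measurable_chaconStep (n : ℕ) : Measurable (chaconStep n) := by
  have hs : ∀ p l, MeasurableSet (openSquare p l) := fun p l =>
    (isOpen_openSquare p l).measurableSet
  have ha : ∀ t : Torus2, Measurable (fun x : Torus2 => x + t) := fun t => measurable_id.add_const t
  induction n with
  | zero => exact measurable_id
  | succ n ih =>
    rcases n with _ | n
    · simp only [chaconStep]
      exact Measurable.ite (hs _ _) (ha _) (Measurable.ite (hs _ _) (ha _)
        (Measurable.ite (hs _ _) (ha _) measurable_id))
    · have hU : MeasurableSet
          {x | ∃ i, 1 ≤ i ∧ i < columnHeight (n + 2) ∧ x ∈ openLevel (n + 2) i} := by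
        have : {x | ∃ i, 1 ≤ i ∧ i < columnHeight (n + 2) ∧ x ∈ openLevel (n + 2) i} =
            ⋃ i, ⋃ (_ : 1 ≤ i), ⋃ (_ : i < columnHeight (n + 2)), openLevel (n + 2) i := by
          ext x; simp only [mem_ofPred_eq, mem_iUnion, exists_prop]
        rw [this]
        exact .iUnion fun i => .iUnion fun _ => .iUnion fun _ => hs _ _
      simp only [chaconStep]
      exact Measurable.ite hU ih (Measurable.ite (hs _ _) (ha _) (Measurable.ite (hs _ _) (ha _)
        (Measurable.ite (hs _ _) (ha _) (Measurable.ite (hs _ _) (ha _)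
        (Measurable.ite (hs _ _) (ha _) (Measurable.ite (hs _ _) (ha _)
        (Measurable.ite (hs _ _) (ha _) measurable_id)))))))

theorem measurable_chaconMap : Measurable chaconMap :=
  measurable_of_tendsto_metrizable measurable_chaconStep (tendsto_pi_nhds.2 tendsto_chaconStep)

theorem chaconMap_injective : Function.Injective chaconMap := by
  intro x y hxy
  by_cases hx : x ∈ regularPoints
  · have hy : y ∈ regularPoints := by
      rwa [← chaconMap_mem_regularPoints_iff, ← hxy, chaconMap_mem_regularPoints_iff]
    -- One column contains both points below its top; equal images lie in the same level, so both
    -- points were moved by the same vector.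
    obtain ⟨N, ⟨i, hi1, hi, hic⟩, ⟨j, hj1, hj, hjc⟩⟩ :=
      ((eventually_exists_level x).and (eventually_exists_level y)).exists
    have hij : i + 1 = j + 1 := by
      refine levelCell_inj (N := N) ⟨by omega, by omega⟩ ⟨by omega, by omega⟩ ?_
      rw [← cellOf_chaconMap hx hi1.le hi hic, ← cellOf_chaconMap hy hj1.le hj hjc, hxy]
    obtain rfl : i = j := by omega
    rw [chaconMap_eq_add_cellShift hx hi1.le hi hic,
      chaconMap_eq_add_cellShift hy hj1.le hj hjc] at hxy
    exact add_right_cancel hxy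
  · have hy : y ∉ regularPoints := by
      rwa [← chaconMap_mem_regularPoints_iff, ← hxy, chaconMap_mem_regularPoints_iff]
    rwa [chaconMap_of_notMem hx, chaconMap_of_notMem hy] at hxy

theorem chaconMap_surjective : Function.Surjective chaconMap := by
  intro y
  by_cases hy : y ∈ regularPoints
  · obtain ⟨N, i, hi1, hi, hic⟩ := (eventually_exists_level y).exists
    -- The preimage is found one level down, which exists because the level of `y` is not the first.
    obtain ⟨i, rfl⟩ := Nat.exists_eq_add_of_le' hi1.le
    refine ⟨y + cellShift N (levelCell (N + 1) (i + 1)) (levelCell (N + 1) i), ?_⟩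
    rw [chaconMap_eq_add_cellShift ((add_mem_regularPoints_iff (isDyadic_cellShift _ _ _)).2 hy)
      (i := i) (by omega) (by omega)
      (cellOf_add_cellShift hic (levelCell_lt _ _).1 (levelCell_lt _ _).2), add_assoc,
      cellShift_add_cellShift, cellShift_self, add_zero]
  · exact ⟨y, chaconMap_of_notMem hy⟩

/-- A measurable bijection of a group that moves every point by an element of a countable set
preserves every invariant measure. -/
theorem measurePreserving_of_bijective_of_sub_mem_countable {G : Type*} [AddCommGroup G]
    [MeasurableSpace G] [MeasurableAdd G] [MeasurableSub₂ G] [MeasurableSingletonClass G]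
    (μ : Measure G) [μ.IsAddRightInvariant] {T : G → G} (hT : Measurable T)
    (hb : Function.Bijective T) {C : Set G} (hC : C.Countable) (h : ∀ x, T x - x ∈ C) :
    MeasurePreserving T μ μ := by
  refine ⟨hT, ?_⟩
  ext A hA
  rw [Measure.map_apply hT hA]
  have : Countable C := hC.to_subtype
  set E : C → Set G := fun c => {x | T x - x = c}
  have hE : ∀ c, MeasurableSet (E c) := fun c =>
    (hT.sub measurable_id) (measurableSet_singleton (c : G))
  have hEU : ⋃ c, E c = univ := eq_univ_of_forall fun x => mem_iUnion.2 ⟨⟨_, h x⟩, rfl⟩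
  have hEd : Pairwise (Function.onFun Disjoint E) := fun c d hcd =>
    disjoint_left.2 fun x hc hd => hcd (Subtype.ext (hc.symm.trans hd))
  -- On the piece `E c` the map is translation by c. The pieces partition the group, and so do their
  -- images, by bijectivity.
  have himg : ∀ c, T '' E c = (fun x => x + -(c : G)) ⁻¹' E c := by
    intro c
    ext y
    constructor
    · rintro ⟨x, hx, rfl⟩
      have hx' : T x - x = c := hx
      have : T x + -(c : G) = x := by rw [← hx']; abel
      rwa [mem_preimage, this]
    · intro hy
      have hy' : T (y + -(c : G)) - (y + -(c : G)) = c := hy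
      refine ⟨_, hy, ?_⟩
      rw [sub_eq_iff_eq_add] at hy'
      rw [hy']; abel
  have hTE : ∀ c, MeasurableSet (T '' E c) := fun c => by
    rw [himg]
    exact (measurable_add_const _) (hE c)
  have hTU : ⋃ c, T '' E c = univ := by rw [← image_iUnion, hEU, image_univ, hb.2.range_eq]
  have hTd : Pairwise (Function.onFun Disjoint fun c => T '' E c) := fun c d hcd =>
    (disjoint_image_iff hb.1).2 (hEd hcd)
  have hpiece : ∀ c, μ (T ⁻¹' A ∩ E c) = μ (A ∩ T '' E c) := by
    intro c
    rw [← measure_preimage_add_right μ (c : G) (A ∩ T '' E c)]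
    congr 1
    ext x
    rw [himg]
    simp only [mem_inter_iff, mem_preimage, add_neg_cancel_right]
    refine and_congr_left fun hx => ?_
    have hx' : T x - x = c := hx
    rw [← hx', add_sub_cancel]
  calc μ (T ⁻¹' A) = μ (⋃ c, T ⁻¹' A ∩ E c) := by rw [← inter_iUnion, hEU, inter_univ]
    _ = ∑' c, μ (T ⁻¹' A ∩ E c) :=
      measure_iUnion (fun c d hcd => (hEd hcd).mono inter_subset_right inter_subset_right)
        fun c => (hT hA).inter (hE c)
    _ = ∑' c, μ (A ∩ T '' E c) := tsum_congr hpiece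
    _ = μ (⋃ c, A ∩ T '' E c) :=
      (measure_iUnion (fun c d hcd => (hTd hcd).mono inter_subset_right inter_subset_right)
        fun c => hA.inter (hTE c)).symm
    _ = μ A := by rw [← inter_iUnion, hTU, inter_univ]

theorem chaconMap_sub_mem (x : Torus2) :
    chaconMap x - x ∈ {u : UnitAddCircle | IsDyadic u} ×ˢ {u : UnitAddCircle | IsDyadic u} := by
  by_cases hx : x ∈ regularPoints
  · obtain ⟨N, i, h1, hi, hc⟩ := (eventually_exists_level x).exists
    rw [chaconMap_eq_add_cellShift hx h1.le hi hc, add_sub_cancel_left]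
    exact isDyadic_cellShift _ _ _
  · rw [chaconMap_of_notMem hx, sub_self]
    exact ⟨isDyadic_zero, isDyadic_zero⟩

theorem measurePreserving_chaconMap : MeasurePreserving chaconMap volume volume :=
  measurePreserving_of_bijective_of_sub_mem_countable volume measurable_chaconMap
    ⟨chaconMap_injective, chaconMap_surjective⟩ (countable_isDyadic.prod countable_isDyadic)
    chaconMap_sub_mem

theorem isTorusAutomorphism_chaconMap : IsTorusAutomorphism chaconMap := by
  refine ⟨⟨chaconMap_injective, chaconMap_surjective⟩, measurable_chaconMap, fun A hA => ⟨?_, ?_⟩⟩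
  · rw [← measurePreserving_chaconMap.measure_preimage
      (hA.image_of_measurable_injOn measurable_chaconMap
        chaconMap_injective.injOn).nullMeasurableSet, preimage_image_eq A chaconMap_injective]
  · exact measurePreserving_chaconMap.measure_preimage hA.nullMeasurableSet

/-! ### Orbits and return times -/

/-- Two regular points that differ by a dyadic vector are in the same orbit. -/
theorem exists_iterate_eq_of_isDyadic {x t : Torus2} (hx : x ∈ regularPoints)
    (ht : IsDyadic t.1 ∧ IsDyadic t.2) :
    ∃ k, x + t = chaconMap^[k] x ∨ x = chaconMap^[k] (x + t) := by
  obtain ⟨⟨N₁, h₁⟩, ⟨N₂, h₂⟩⟩ := ht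
  -- N is so large that both points lie in levels of one column and `t` is a vector of its grid; the
  -- lower point then climbs to the other.
  obtain ⟨N, ⟨i, hi1, hi, hic⟩, ⟨j, hj1, hj, hjc⟩, hN₁, hN₂⟩ :=
    ((eventually_exists_level x).and ((eventually_exists_level (x + t)).and
      ((eventually_ge_atTop N₁).and (eventually_ge_atTop N₂)))).exists
  have e : t = cellShift N (cellOf N x) (cellOf N (x + t)) :=
    Prod.ext (eq_coe_dyadicIndex_sub (two_pow_nsmul_eq_zero_of_le hN₁ h₁) x.1)
      (eq_coe_dyadicIndex_sub (two_pow_nsmul_eq_zero_of_le hN₂ h₂) x.2)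
  rw [hic, hjc] at e
  rcases le_total i j with hij | hij
  · obtain ⟨k, rfl⟩ := Nat.exists_eq_add_of_le hij
    refine ⟨k, .inl ?_⟩
    rw [chaconMap_iterate hx hi1.le hj.le hic, ← e]
  · obtain ⟨k, rfl⟩ := Nat.exists_eq_add_of_le hij
    refine ⟨k, .inr ?_⟩
    have hxt : x + t ∈ regularPoints :=
      (add_mem_regularPoints_iff ⟨⟨N₁, h₁⟩, ⟨N₂, h₂⟩⟩).2 hx
    rw [chaconMap_iterate hxt hj1.le hi.le hjc, add_assoc]
    have e' : t + cellShift N (levelCell (N + 1) j) (levelCell (N + 1) (j + k)) = 0 := by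
      rw [e, cellShift_add_cellShift, cellShift_self]
    rw [e', add_zero]

/-! ### Return times of the quarters. -/

/-- The regular points in the `q`-th quarters of the levels of the `(N + 1)`-st column. -/
def quarterSet (N q : ℕ) : Set Torus2 :=
  {x | x ∈ regularPoints ∧ ∃ i, 1 ≤ i ∧ i ≤ columnHeight (N + 1) ∧
    cellOf (N + 1) x = cellQuarter (levelCell (N + 1) i) q}

/-- The translation vector from the `p`-th to the `q`-th quarter of a cell of order `N`. -/
noncomputable def quarterShift (N p q : ℕ) : Torus2 :=
  cellShift (N + 1) (cellQuarter (0, 0) p) (cellQuarter (0, 0) q)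

theorem cellShift_cellQuarter_same (N : ℕ) (c : ℕ × ℕ) (p q : ℕ) :
    cellShift (N + 1) (cellQuarter c p) (cellQuarter c q) = quarterShift N p q := by
  rcases p with _ | _ | _ | _ | p <;> rcases q with _ | _ | _ | _ | q <;>
  · simp only [cellShift, cellQuarter, quarterShift]
    push_cast
    congr 2 <;> congr 1 <;> ring

theorem measurableSet_quarterSet (N q : ℕ) : MeasurableSet (quarterSet N q) :=
  measurableSet_regularPoints.inter (measurable_cellOf (N + 1)
    (MeasurableSet.of_discrete (s := {c | ∃ i, 1 ≤ i ∧ i ≤ columnHeight (N + 1) ∧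
      c = cellQuarter (levelCell (N + 1) i) q})))

/-- The second copy of the column stands directly on the first, without a spacer. -/
theorem chaconMap_iterate_of_mem_quarterSet_one {N : ℕ} {x : Torus2} (hx : x ∈ quarterSet N 1) :
    chaconMap^[columnHeight (N + 1)] x = x + quarterShift N 1 2 := by
  obtain ⟨hr, i, h1, hi, hc⟩ := hx
  rw [← levelCell_quarter_one N hi] at hc
  rw [chaconMap_iterate hr h1 (by rw [columnHeight_succ_succ]; omega) hc,
    add_comm i, levelCell_quarter_two N hi h1, levelCell_quarter_one N hi,
    cellShift_cellQuarter_same]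

/-- One spacer separates the second and third copies, hence one more step than for the first
quarters; this discrepancy is the source of weak mixing. -/
theorem chaconMap_iterate_of_mem_quarterSet_two {N : ℕ} {x : Torus2} (hx : x ∈ quarterSet N 2) :
    chaconMap^[columnHeight (N + 1) + 1] x = x + quarterShift N 2 3 := by
  obtain ⟨hr, i, h1, hi, hc⟩ := hx
  rw [← levelCell_quarter_two N hi h1] at hc
  rw [chaconMap_iterate hr (by omega) (by rw [columnHeight_succ_succ]; omega) hc,
    show columnHeight (N + 1) + i + (columnHeight (N + 1) + 1) =
      2 * columnHeight (N + 1) + 1 + i by omega, levelCell_quarter_three N hi h1,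
    levelCell_quarter_two N hi h1, cellShift_cellQuarter_same]

theorem add_quarterShift_mem_quarterSet {N p : ℕ} (q : ℕ) {x : Torus2} (hx : x ∈ quarterSet N p) :
    x + quarterShift N p q ∈ quarterSet N q := by
  obtain ⟨hr, i, h1, hi, hc⟩ := hx
  refine ⟨(add_mem_regularPoints_iff (isDyadic_cellShift _ _ _)).2 hr, i, h1, hi, ?_⟩
  rw [← cellShift_cellQuarter_same N (levelCell (N + 1) i)]
  have := cellQuarter_lt (levelCell_lt N i) q
  exact cellOf_add_cellShift hc this.1 this.2

theorem eventually_exists_mem_quarterSet {x : Torus2} (hx : x ∈ regularPoints) :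
    ∀ᶠ N in atTop, ∃ q, 1 ≤ q ∧ q ≤ 4 ∧ x ∈ quarterSet N q := by
  filter_upwards [eventually_exists_level x] with N hN
  obtain ⟨i, h1, hi, hc⟩ := hN
  obtain ⟨q, hq1, hq4, hq⟩ := exists_cellQuarter (cellOf_succ_div N x).1 (cellOf_succ_div N x).2
  exact ⟨q, hq1, hq4, hx, i, h1.le, hi.le, by rw [hq, hc]⟩

theorem tendsto_quarterShift (p q : ℕ) :
    Tendsto (fun N => quarterShift N p q) atTop (𝓝 0) := by
  have hc : Continuous toTorus2 :=
    ((AddCircle.continuous_mk' (1 : ℝ)).comp continuous_fst).prodMk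
      ((AddCircle.continuous_mk' (1 : ℝ)).comp continuous_snd)
  have h0 : ∀ a : ℝ, Tendsto (fun N : ℕ => a / 2 ^ (N + 1)) atTop (𝓝 0) := fun a =>
    ((tendsto_pow_atTop_atTop_of_one_lt one_lt_two).comp
      (tendsto_add_atTop_nat 1)).const_div_atTop a
  have := (hc.tendsto (0, 0)).comp
    ((h0 (((cellQuarter (0, 0) q).1 : ℝ) - (cellQuarter (0, 0) p).1)).prodMk_nhds
    (h0 (((cellQuarter (0, 0) q).2 : ℝ) - (cellQuarter (0, 0) p).2)))
  have e : toTorus2 (0, 0) = 0 := by simp [toTorus2]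
  rw [e] at this
  exact this

/-! ### Ergodicity of the product -/

open scoped symmDiff in
/-- Translation is continuous in measure. -/
theorem tendsto_measure_symmDiff_preimage_add_right {G : Type*} [AddCommGroup G]
    [TopologicalSpace G] [IsTopologicalAddGroup G] [R1Space G] [MeasurableSpace G] [BorelSpace G]
    {μ : Measure G} [IsFiniteMeasure μ] [μ.IsAddRightInvariant] [μ.InnerRegularCompactLTTop]
    {A : Set G} (hA : MeasurableSet A) {s : ℕ → G} (hs : Tendsto s atTop (𝓝 0)) :
    Tendsto (fun n => μ (((fun x => x + s n) ⁻¹' A) ∆ A)) atTop (𝓝 0) := by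
  -- Currying addition makes the translation depend continuously on its vector in the compact-open
  -- topology, as the Mathlib lemma on preimages requires.
  let f : C(G, C(G, G)) :=
    ContinuousMap.curry ⟨fun p : G × G => p.2 + p.1, continuous_snd.add continuous_fst⟩
  have hf : ∀ t, MeasurePreserving (f t) μ μ := fun t => measurePreserving_add_right μ t
  have h := tendsto_measure_symmDiff_preimage_nhds_zero ((f.continuous.tendsto 0).comp hs)
    (Eventually.of_forall fun n => hf (s n)) (hf 0) hA.nullMeasurableSet (measure_ne_top _ _)
  have h0 : (f 0) ⁻¹' A = A := by
    ext x
    exact iff_of_eq (congrArg (· ∈ A) (add_zero x))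
  rw [h0] at h
  exact h

open scoped symmDiff in
/-- A set that is asymptotically disjoint from sets `E n`, finitely many small translates of
which almost cover the group, is null. -/
theorem measure_eq_zero_of_tendsto_measure_inter {G : Type*} [AddCommGroup G]
    [TopologicalSpace G] [IsTopologicalAddGroup G] [R1Space G] [MeasurableSpace G] [BorelSpace G]
    {μ : Measure G} [IsFiniteMeasure μ] [μ.IsAddRightInvariant] [μ.InnerRegularCompactLTTop]
    {ι : Type*} [Fintype ι] {s : ι → ℕ → G} (hs : ∀ i, Tendsto (s i) atTop (𝓝 0))
    {E : ℕ → Set G} (hE : ∀ n, MeasurableSet (E n))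
    (hcov : ∀ᵐ x ∂μ, ∀ᶠ n in atTop, ∃ i, x + s i n ∈ E n)
    {D : Set G} (hD : MeasurableSet D) (hDE : Tendsto (fun n => μ (D ∩ E n)) atTop (𝓝 0)) :
    μ D = 0 := by
  -- The uncovered part of `D`: almost every point leaves it eventually, so its measure tends to 0.
  set F : ℕ → Set G := fun n => D \ ⋃ i, (fun x => x + s i n) ⁻¹' E n
  have hF : Tendsto (fun n => μ (F n)) atTop (𝓝 0) := by
    rw [← measure_empty (μ := μ)]
    refine tendsto_measure_of_ae_tendsto_indicator_of_isFiniteMeasure atTop MeasurableSet.empty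
      (fun n => hD.diff (.iUnion fun i => measurable_add_const _ (hE n))) ?_
    filter_upwards [hcov] with x hx
    filter_upwards [hx] with n hn
    exact iff_of_false (fun hxF => hxF.2 (mem_iUnion.2 hn)) (notMem_empty x)
  have hi : ∀ i, Tendsto (fun n => μ (D ∩ (fun x => x + s i n) ⁻¹' E n)) atTop (𝓝 0) := by
    intro i
    have hneg : Tendsto (fun n => -s i n) atTop (𝓝 0) := by simpa using (hs i).neg
    have hsum := hDE.add (tendsto_measure_symmDiff_preimage_add_right (μ := μ) hD hneg)
    rw [add_zero] at hsum
    refine tendsto_of_tendsto_of_tendsto_of_le_of_le tendsto_const_nhds hsum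
      (fun n => zero_le) fun n => ?_
    -- Translating back turns this set into a slightly moved `D` intersected with `E n`, which
    -- differs from `D ∩ E n` by a small symmetric difference.
    have e : D ∩ (fun x => x + s i n) ⁻¹' E n =
        (fun x => x + s i n) ⁻¹' (((fun x => x + -s i n) ⁻¹' D) ∩ E n) := by
      ext x; simp
    simp only
    rw [e, measure_preimage_add_right]
    refine (measure_mono ?_).trans (measure_union_le _ _)
    rintro x ⟨hx1, hx2⟩
    by_cases hx : x ∈ D
    · exact .inl ⟨hx, hx2⟩
    · exact .inr (.inl ⟨hx1, hx⟩)
  have hlim := (tendsto_finsetSum Finset.univ fun i _ => hi i).add hF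
  simp only [Finset.sum_const_zero, add_zero] at hlim
  refine le_antisymm (ge_of_tendsto' hlim fun n => ?_) zero_le
  calc μ D ≤ μ ((⋃ i, D ∩ (fun x => x + s i n) ⁻¹' E n) ∪ F n) := by
        refine measure_mono fun x hx => ?_
        by_cases h : x ∈ ⋃ i, (fun x => x + s i n) ⁻¹' E n
        · refine .inl ?_
          rw [← inter_iUnion]
          exact ⟨hx, h⟩
        · exact .inr ⟨hx, h⟩
    _ ≤ _ := (measure_union_le _ _).trans (by gcongr; exact measure_iUnion_fintype_le _ _)

/-- A set that is almost invariant under a map is almost invariant under every translation along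
the orbits of the map. -/
theorem preimage_add_right_ae_eq_of_orbit {G : Type*} [AddCommGroup G] [MeasurableSpace G]
    [MeasurableAdd G] {μ : Measure G} [μ.IsAddRightInvariant] {R : G → G}
    (hR : Measure.QuasiMeasurePreserving R μ μ) {A : Set G} (hA : R ⁻¹' A =ᵐ[μ] A) {s : G}
    (hs : ∀ᵐ x ∂μ, ∃ k, x + s = R^[k] x ∨ x = R^[k] (x + s)) :
    (fun x => x + s) ⁻¹' A =ᵐ[μ] A := by
  have h1 : ∀ᵐ x ∂μ, ∀ k, R^[k] x ∈ A ↔ x ∈ A := by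
    rw [ae_all_iff]
    intro k
    exact (hR.preimage_iterate_ae_eq k hA).mem_iff
  have h2 : ∀ᵐ x ∂μ, ∀ k, R^[k] (x + s) ∈ A ↔ x + s ∈ A :=
    (measurePreserving_add_right μ s).quasiMeasurePreserving.ae h1
  refine eventuallyEq_set.2 ?_
  filter_upwards [h1, h2, hs] with x hx1 hx2 ⟨k, hk⟩
  rw [mem_preimage]
  rcases hk with hk | hk
  · rw [hk]; exact hx1 k
  · rw [← hx2 k, ← hk]

section

variable {G : Type*} [AddCommGroup G] [TopologicalSpace G] [IsTopologicalAddGroup G]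
  [CompactSpace G] [SecondCountableTopology G] [MeasurableSpace G] [BorelSpace G]
  {μ : Measure G} [μ.IsAddHaarMeasure] [IsProbabilityMeasure μ]

open scoped symmDiff in
/-- A set invariant under `T × T` is almost invariant under `id × T`, if `T ^ h n` and
`T ^ (h n + 1)` are small translations on sets of which finitely many small translates cover. -/
theorem preimage_id_prodMap_ae_eq {T : G → G} (hT : MeasurePreserving T μ μ)
    {ι : Type*} [Fintype ι] {P Q : ℕ → Set G} (hPm : ∀ n, MeasurableSet (P n))
    (hQm : ∀ n, MeasurableSet (Q n)) {h : ℕ → ℕ} {v w : ℕ → G} (hv : Tendsto v atTop (𝓝 0))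
    (hw : Tendsto w atTop (𝓝 0)) (hP : ∀ n, ∀ x ∈ P n, T^[h n] x = x + v n)
    (hQ : ∀ n, ∀ x ∈ Q n, T^[h n + 1] x = x + w n) {a b : ι → ℕ → G}
    (ha : ∀ i, Tendsto (a i) atTop (𝓝 0)) (hb : ∀ i, Tendsto (b i) atTop (𝓝 0))
    (hPc : ∀ᵐ x ∂μ, ∀ᶠ n in atTop, ∃ i, x + a i n ∈ P n)
    (hQc : ∀ᵐ x ∂μ, ∀ᶠ n in atTop, ∃ i, x + b i n ∈ Q n)
    {A : Set (G × G)} (hA : MeasurableSet A) (hAT : Prod.map T T ⁻¹' A = A) :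
    Prod.map id T ⁻¹' A =ᵐ[μ.prod μ] A := by
  rw [← measure_symmDiff_eq_zero_iff]
  have hB : MeasurableSet (Prod.map id T ⁻¹' A) := (measurable_id.prodMap hT.measurable) hA
  refine measure_eq_zero_of_tendsto_measure_inter (μ := μ.prod μ)
    (s := fun (i : ι × ι) n => (a i.1 n, b i.2 n))
    (fun i => (ha i.1).prodMk_nhds (hb i.2)) (E := fun n => P n ×ˢ Q n)
    (fun n => (hPm n).prod (hQm n)) ?_ (hB.symmDiff hA) ?_
  · filter_upwards [Measure.quasiMeasurePreserving_fst.ae hPc,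
      Measure.quasiMeasurePreserving_snd.ae hQc] with z h1 h2
    filter_upwards [h1, h2] with n ⟨i, hi⟩ ⟨j, hj⟩
    exact ⟨(i, j), hi, hj⟩
  · refine tendsto_of_tendsto_of_tendsto_of_le_of_le tendsto_const_nhds
      (tendsto_measure_symmDiff_preimage_add_right (μ := μ.prod μ) hA (hv.prodMk_nhds hw))
      (fun n => zero_le) fun n => measure_mono ?_
    rintro ⟨x, y⟩ ⟨hxy, hx, hy⟩
    have hk : ∀ k z, (Prod.map T T)^[k] z ∈ A ↔ z ∈ A := fun k z => by
      have : ((Prod.map T T)^[k]) ⁻¹' A = A := by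
        rw [preimage_iterate_eq, Function.iterate_fixed hAT]
      exact Set.ext_iff.1 this z
    -- Applying `T × T` to (x, Ty) `h n` times gives (x + v, y + w): the second coordinate has made
    -- one step more.
    have key : (x, y) ∈ Prod.map id T ⁻¹' A ↔ (x, y) ∈ (fun z => z + (v n, w n)) ⁻¹' A := by
      have := hk (h n) (x, T y)
      rw [Prod.map_iterate, Prod.map_apply, hP n x hx, ← Function.iterate_succ_apply,
        hQ n y hy] at this
      exact this.symm
    rw [mem_symmDiff] at hxy ⊢
    rwa [← key]

/-- A criterion for double ergodicity. -/
theorem ergodic_prodMap_of_orbit {T : G → G} (hT : MeasurePreserving T μ μ)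
    (horb : Dense {t : G | ∀ᵐ x ∂μ, ∃ k, x + t = T^[k] x ∨ x = T^[k] (x + t)})
    (hinv : ∀ A : Set (G × G), MeasurableSet A → Prod.map T T ⁻¹' A = A →
      Prod.map id T ⁻¹' A =ᵐ[μ.prod μ] A) :
    Ergodic (Prod.map T T) (μ.prod μ) := by
  refine ⟨hT.prod hT, ⟨fun A hA hAT => ?_⟩⟩
  have h2 := hinv A hA hAT
  have hq1 : Measure.QuasiMeasurePreserving (Prod.map T id) (μ.prod μ) (μ.prod μ) :=
    (hT.prod (MeasurePreserving.id μ)).quasiMeasurePreserving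
  have hq2 : Measure.QuasiMeasurePreserving (Prod.map id T) (μ.prod μ) (μ.prod μ) :=
    ((MeasurePreserving.id μ).prod hT).quasiMeasurePreserving
  have h1 : Prod.map T id ⁻¹' A =ᵐ[μ.prod μ] A := by
    -- As `T × T` factors through both maps, almost invariance under `id × T` passes to `T × id`.
    have e : Prod.map T id ⁻¹' (Prod.map id T ⁻¹' A) = A := by
      rw [← preimage_comp, Prod.map_comp_map]; exact hAT
    have := hq1.preimage_ae_eq h2
    rw [e] at this
    exact this.symm
  refine aeconst_of_dense_setOfPred_preimage_vadd_ae (M := G × G) hA.nullMeasurableSet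
    ((horb.prod horb).mono ?_)
  rintro ⟨s, t⟩ ⟨hs, ht⟩
  have e1 : (fun z => z + (s, 0)) ⁻¹' A =ᵐ[μ.prod μ] A := by
    refine preimage_add_right_ae_eq_of_orbit hq1 h1 ?_
    filter_upwards [Measure.quasiMeasurePreserving_fst.ae hs] with z ⟨k, hk⟩
    refine ⟨k, hk.imp (fun hk => ?_) fun hk => ?_⟩ <;>
      rw [Prod.map_iterate, Function.iterate_id]
    · exact Prod.ext hk (add_zero z.2)
    · exact Prod.ext hk (add_zero z.2).symm
  have e2 : (fun z => z + (0, t)) ⁻¹' A =ᵐ[μ.prod μ] A := by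
    refine preimage_add_right_ae_eq_of_orbit hq2 h2 ?_
    filter_upwards [Measure.quasiMeasurePreserving_snd.ae ht] with z ⟨k, hk⟩
    refine ⟨k, hk.imp (fun hk => ?_) fun hk => ?_⟩ <;>
      rw [Prod.map_iterate, Function.iterate_id]
    · exact Prod.ext (add_zero z.1) hk
    · exact Prod.ext (add_zero z.1).symm hk
  have e3 := ((measurePreserving_add_right (μ.prod μ) (s, 0)).quasiMeasurePreserving.preimage_ae_eq
    e2).trans e1
  have e4 : (fun z : G × G => (s, t) +ᵥ z) ⁻¹' A =
      (fun z => z + (s, 0)) ⁻¹' ((fun z => z + (0, t)) ⁻¹' A) := by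
    ext ⟨x, y⟩
    simp [add_comm]
  rw [mem_ofPred_eq, e4]
  exact e3

end

/-! ### Application of the criterion to the Chacon map. -/

theorem dense_orbit_chaconMap :
    Dense {t : Torus2 |
      ∀ᵐ x : Torus2, ∃ k, x + t = chaconMap^[k] x ∨ x = chaconMap^[k] (x + t)} := by
  refine (dense_isDyadic.prod dense_isDyadic).mono fun t ht => ?_
  filter_upwards [ae_mem_regularPoints] with x hx
  exact exists_iterate_eq_of_isDyadic hx ht

theorem ae_eventually_exists_add_mem_quarterSet (q : ℕ) :
    ∀ᵐ x : Torus2, ∀ᶠ N in atTop, ∃ p : Fin 4, x + quarterShift N (p + 1) q ∈ quarterSet N q := by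
  filter_upwards [ae_mem_regularPoints] with x hx
  filter_upwards [eventually_exists_mem_quarterSet hx] with N ⟨p, h1, h4, hp⟩
  refine ⟨⟨p - 1, by omega⟩, ?_⟩
  simp only [Nat.sub_add_cancel h1]
  exact add_quarterShift_mem_quarterSet q hp

theorem ergodic_prodMap_chaconMap :
    Ergodic (Prod.map chaconMap chaconMap) ((volume : Measure Torus2).prod volume) :=
  ergodic_prodMap_of_orbit measurePreserving_chaconMap dense_orbit_chaconMap
    fun _ hA hAT => preimage_id_prodMap_ae_eq measurePreserving_chaconMap
      (fun N => measurableSet_quarterSet N 1) (fun N => measurableSet_quarterSet N 2)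
      (tendsto_quarterShift 1 2) (tendsto_quarterShift 2 3)
      (fun _ _ => chaconMap_iterate_of_mem_quarterSet_one)
      (fun _ _ => chaconMap_iterate_of_mem_quarterSet_two)
      (fun p : Fin 4 => tendsto_quarterShift (p + 1) 1)
      (fun p : Fin 4 => tendsto_quarterShift (p + 1) 2)
      (ae_eventually_exists_add_mem_quarterSet 1) (ae_eventually_exists_add_mem_quarterSet 2)
      hA hAT

/-! ### Weak mixing -/

/-- The mean ergodic theorem for sets. -/
theorem Ergodic.tendsto_average_measureReal_preimage_inter {X : Type*} [MeasurableSpace X]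
    {μ : Measure X} [IsProbabilityMeasure μ] {f : X → X} (hf : Ergodic f μ) {A B : Set X}
    (hA : MeasurableSet A) (hB : MeasurableSet B) :
    Tendsto (fun n : ℕ => (1 / (n : ℝ)) * ∑ j ∈ Finset.range n, μ.real (f^[j] ⁻¹' A ∩ B)) atTop
      (𝓝 (μ.real A * μ.real B)) := by
  have hmp := hf.toMeasurePreserving
  set K : Lp ℝ 2 μ →L[ℝ] Lp ℝ 2 μ :=
    (Lp.compMeasurePreservingₗᵢ (E := ℝ) (p := 2) ℝ f hmp).toContinuousLinearMap with hK
  set a : Lp ℝ 2 μ := indicatorConstLp 2 hA (measure_ne_top μ A) (1 : ℝ) with ha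
  have hKj : ∀ j : ℕ, K^[j] a = indicatorConstLp 2 (hmp.measurable.iterate j hA)
      (measure_ne_top μ _) (1 : ℝ) := by
    intro j
    induction j with
    | zero => rfl
    | succ j ih =>
      rw [Function.iterate_succ_apply', ih]
      rfl
  set P := (K.eqLocus (1 : Lp ℝ 2 μ →L[ℝ] Lp ℝ 2 μ)).orthogonalProjectionOnto a with hP
  have hlim : Tendsto (birkhoffAverage ℝ K _root_.id · a) atTop (𝓝 (P : Lp ℝ 2 μ)) :=
    K.tendsto_birkhoffAverage_orthogonalProjection
      (LinearIsometry.norm_toContinuousLinearMap_le _) a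
  have havg : ∀ {C : Set X} (hC : MeasurableSet C) (n : ℕ),
      inner ℝ (indicatorConstLp 2 hC (measure_ne_top μ C) (1 : ℝ))
          (birkhoffAverage ℝ K _root_.id n a) =
        (1 / (n : ℝ)) * ∑ j ∈ Finset.range n, μ.real (f^[j] ⁻¹' A ∩ C) := by
    intro C hC n
    rw [birkhoffAverage, birkhoffSum, inner_smul_right, inner_sum, one_div]
    congr 1
    refine Finset.sum_congr rfl fun j _ => ?_
    rw [_root_.id, hKj, L2.inner_indicatorConstLp_indicatorConstLp, inter_comm]
    simp
  -- The limit of the averages is a fixed function, hence constant by ergodicity; testing against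
  -- the whole space below identifies the constant.
  obtain ⟨c, hc⟩ : ∃ c : ℝ, ((P : Lp ℝ 2 μ) : X → ℝ) =ᵐ[μ] Function.const X c := by
    have hfix : K (P : Lp ℝ 2 μ) = P := P.2
    refine hf.ae_eq_const_of_ae_eq_comp_ae (Lp.aestronglyMeasurable _) ?_
    have := Lp.coeFn_compMeasurePreserving (P : Lp ℝ 2 μ) hmp
    have e : Lp.compMeasurePreserving f hmp (P : Lp ℝ 2 μ) = P := hfix
    rw [e] at this
    exact this.symm
  have hlimC : ∀ {C : Set X}, MeasurableSet C →
      Tendsto (fun n : ℕ => (1 / (n : ℝ)) * ∑ j ∈ Finset.range n, μ.real (f^[j] ⁻¹' A ∩ C)) atTop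
        (𝓝 (c * μ.real C)) := by
    intro C hC
    have h := (tendsto_const_nhds (x := indicatorConstLp 2 hC (measure_ne_top μ C) (1 : ℝ))).inner
      (𝕜 := ℝ) hlim
    simp only [havg hC] at h
    convert h using 2
    rw [L2.inner_indicatorConstLp_one, setIntegral_congr_ae hC (hc.mono fun x hx _ => hx)]
    simp [mul_comm]
  have hcA : c = μ.real A := by
    have h := hlimC MeasurableSet.univ
    rw [probReal_univ, mul_one] at h
    refine tendsto_nhds_unique h (tendsto_const_nhds.congr' ?_)
    filter_upwards [eventually_gt_atTop 0] with n hn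
    have : ∀ j, μ.real (f^[j] ⁻¹' A ∩ univ) = μ.real A := fun j => by
      rw [inter_univ, (hmp.iterate j).measureReal_preimage hA.nullMeasurableSet]
    simp only [this]
    rw [Finset.sum_const, Finset.card_range, nsmul_eq_mul]
    field_simp
  rw [← hcA]
  exact hlimC hB

/-- Ergodicity of `T × T` gives weak mixing of `T`. -/
theorem tendsto_average_sq_of_ergodic_prodMap {X : Type*} [MeasurableSpace X]
    {μ : Measure X} [IsProbabilityMeasure μ] {T : X → X} (h : Ergodic (Prod.map T T) (μ.prod μ))
    {A B : Set X} (hA : MeasurableSet A) (hB : MeasurableSet B) :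
    Tendsto (fun n : ℕ => (1 / (n : ℝ)) * ∑ j ∈ Finset.range n,
      (μ.real (T^[j] ⁻¹' A ∩ B) - μ.real A * μ.real B) ^ 2) atTop (𝓝 0) := by
  have hpre : ∀ (j : ℕ) (C D C' D' : Set X), (μ.prod μ).real
      ((Prod.map T T)^[j] ⁻¹' (C ×ˢ C') ∩ D ×ˢ D') =
      μ.real (T^[j] ⁻¹' C ∩ D) * μ.real (T^[j] ⁻¹' C' ∩ D') := by
    intro j C D C' D'
    rw [Prod.map_iterate, ← measureReal_prod_prod, ← prod_inter_prod]
    rfl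
  -- Rectangles with a full second factor give the averages of the correlations, and `A ×ˢ A`, `B ×ˢ
  -- B` those of their squares; the square is then expanded.
  have h1 := h.tendsto_average_measureReal_preimage_inter (hA.prod MeasurableSet.univ)
    (hB.prod MeasurableSet.univ)
  have h2 := h.tendsto_average_measureReal_preimage_inter (hA.prod hA) (hB.prod hB)
  simp only [hpre, measureReal_prod_prod, preimage_univ, inter_univ, probReal_univ,
    mul_one] at h1 h2
  have h3 := (h2.sub (h1.const_mul (2 * (μ.real A * μ.real B)))).add_const
    ((μ.real A * μ.real B) ^ 2)
  have e : μ.real A * μ.real A * (μ.real B * μ.real B) -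
      2 * (μ.real A * μ.real B) * (μ.real A * μ.real B) + (μ.real A * μ.real B) ^ 2 = 0 := by ring
  rw [e] at h3
  refine h3.congr' ?_
  filter_upwards [eventually_gt_atTop 0] with n hn
  have hn' : (n : ℝ) ≠ 0 := by positivity
  have hsum : ∑ j ∈ Finset.range n, (μ.real (T^[j] ⁻¹' A ∩ B) - μ.real A * μ.real B) ^ 2 =
      ∑ j ∈ Finset.range n, μ.real (T^[j] ⁻¹' A ∩ B) * μ.real (T^[j] ⁻¹' A ∩ B) -
        2 * (μ.real A * μ.real B) * ∑ j ∈ Finset.range n, μ.real (T^[j] ⁻¹' A ∩ B) +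
        n * (μ.real A * μ.real B) ^ 2 := by
    rw [Finset.mul_sum, ← Finset.sum_sub_distrib]
    have hcst : (n : ℝ) * (μ.real A * μ.real B) ^ 2 =
        ∑ _j ∈ Finset.range n, (μ.real A * μ.real B) ^ 2 := by simp
    rw [hcst, ← Finset.sum_add_distrib]
    exact Finset.sum_congr rfl fun j _ => by ring
  rw [hsum]
  field_simp

theorem isWeaklyMixing_chaconMap : IsWeaklyMixing chaconMap := fun _ _ hA hB =>
  tendsto_average_sq_of_ergodic_prodMap ergodic_prodMap_chaconMap hA hB

/-! ### Eigenvalues of the Koopman operator. -/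

/-- If `T × T` is ergodic, the only eigenvalue of the Koopman operator is `1`. -/
theorem eigenvalue_eq_one_of_ergodic_prodMap {X : Type*} [MeasurableSpace X]
    {μ : Measure X} [IsProbabilityMeasure μ] {T : X → X} (h : Ergodic (Prod.map T T) (μ.prod μ))
    (hT : MeasurePreserving T μ μ) {z : ℂ}
    (hz : Module.End.HasEigenvalue
      (Lp.compMeasurePreservingₗᵢ (E := ℂ) (p := 2) ℂ T hT).toLinearMap z) : z = 1 := by
  obtain ⟨f, hf⟩ := hz.exists_hasEigenvector
  have hf0 := hf.2
  have hfz : Lp.compMeasurePreservingₗᵢ (E := ℂ) (p := 2) ℂ T hT f = z • f := hf.apply_eq_smul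
  have hz1 : ‖z‖ = 1 := by
    have := congrArg norm hfz
    rw [LinearIsometry.norm_map, norm_smul] at this
    exact (mul_eq_right₀ (norm_ne_zero_iff.2 hf0)).1 this.symm
  have hcomp : ∀ᵐ x ∂μ, f (T x) = z * f x := by
    have h1 := Lp.coeFn_compMeasurePreserving f hT
    have e : Lp.compMeasurePreserving T hT f = z • f := hfz
    rw [e] at h1
    filter_upwards [h1, Lp.coeFn_smul z f] with x hx1 hx2
    rw [← Function.comp_apply (f := f), ← hx1, hx2, Pi.smul_apply, smul_eq_mul]
  have hfm := Lp.aestronglyMeasurable f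
  have hgm : AEStronglyMeasurable (fun p : X × X => f p.1 * star (f p.2)) (μ.prod μ) :=
    (hfm.comp_quasiMeasurePreserving Measure.quasiMeasurePreserving_fst).mul
      (hfm.comp_quasiMeasurePreserving Measure.quasiMeasurePreserving_snd).star
  obtain ⟨c, hc⟩ := h.ae_eq_const_of_ae_eq_comp_ae hgm (by
    filter_upwards [Measure.quasiMeasurePreserving_fst.ae hcomp,
      Measure.quasiMeasurePreserving_snd.ae hcomp] with p hp1 hp2
    have hzz : z * star z = 1 := by
      rw [Complex.star_def, Complex.mul_conj, Complex.normSq_eq_norm_sq, hz1]; simp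
    simp only [Function.comp_apply, Prod.map_fst, Prod.map_snd, hp1, hp2, star_mul']
    calc z * f p.1 * (star z * star (f p.2)) = (z * star z) * (f p.1 * star (f p.2)) := by ring
      _ = _ := by rw [hzz, one_mul])
  have hne : ∃ᵐ x ∂μ, f x ≠ 0 := by
    intro hcon
    refine hf0 (Lp.eq_zero_iff_ae_eq_zero.2 ?_)
    filter_upwards [hcon] with x hx using not_not.1 hx
  -- Fixing a good x with `f x ≠ 0` in the constant product shows that f itself is almost everywhere
  -- constant.
  obtain ⟨x, hx0, hx⟩ := (hne.and_eventually (Measure.ae_ae_of_ae_prod hc)).exists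
  have hconst : ∀ᵐ y ∂μ, f y = star (c / f x) := by
    filter_upwards [hx] with y hy
    have hy' : f x * star (f y) = c := hy
    rw [← hy', mul_div_cancel_left₀ _ hx0, star_star]
  obtain ⟨y, hy0, hy1, hy2, hy3⟩ := (hne.and_eventually
    (hconst.and ((hT.quasiMeasurePreserving.ae hconst).and hcomp))).exists
  rw [hy2, ← hy1] at hy3
  exact ((mul_eq_right₀ hy0).1 hy3.symm)

/-! ### Recurrence of the levels and failure of strong mixing -/

theorem exists_levelCell_add {N i : ℕ} (hi : 1 ≤ i ∧ i ≤ columnHeight (N + 1)) {x : Torus2}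
    (hc : cellOf N x = levelCell (N + 1) i) (m : ℕ) :
    ∃ j, 1 ≤ j ∧ j ≤ columnHeight (N + m + 1) ∧ cellOf (N + m) x = levelCell (N + m + 1) j := by
  induction m with
  | zero => exact ⟨i, hi.1, hi.2, hc⟩
  | succ m ih =>
    obtain ⟨j, hj1, hj, hjc⟩ := ih
    obtain ⟨l, h1, h2, h3⟩ := exists_levelCell_succ ⟨hj1, hj⟩ hjc
    exact ⟨l, h1, h2.le, h3⟩

theorem cellOf_eq_of_add {N m : ℕ} {x y : Torus2} (h : cellOf (N + m) x = cellOf (N + m) y) :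
    cellOf N x = cellOf N y := by
  simp only [cellOf, Prod.mk.injEq] at h
  rw [cellOf, cellOf, ← dyadicIndex_add_div N m, ← dyadicIndex_add_div N m,
    ← dyadicIndex_add_div N m y.1, ← dyadicIndex_add_div N m y.2, h.1, h.2]

/-- The regular points of the level `Q_{N+1,i}`. -/
def regularLevel (N i : ℕ) : Set Torus2 :=
  {x | x ∈ regularPoints ∧ cellOf N x = levelCell (N + 1) i}

theorem measurableSet_regularLevel (N i : ℕ) : MeasurableSet (regularLevel N i) :=
  measurableSet_regularPoints.inter (measurable_cellOf N (measurableSet_singleton _))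

theorem regularLevel_subset_level (N i : ℕ) : regularLevel N i ⊆ level (N + 1) i :=
  fun _ hx => (mem_level_iff hx.1).2 hx.2

theorem volume_level (N i : ℕ) : volume (level (N + 1) i) = volume (regularLevel N i) := by
  refine measure_congr (eventuallyEq_set.2 ?_)
  filter_upwards [ae_mem_regularPoints] with x hx
  rw [mem_level_iff hx]
  exact ⟨fun h => ⟨hx, h⟩, fun h => h.2⟩

theorem measurableSet_level (n i : ℕ) : MeasurableSet (level n i) := by
  rw [level, closedSquare_eq]
  exact ((isCompact_Icc.image (AddCircle.continuous_mk' (1 : ℝ))).isClosed.measurableSet).prod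
    ((isCompact_Icc.image (AddCircle.continuous_mk' (1 : ℝ))).isClosed.measurableSet)

theorem volume_regularLevel_eq (N i j : ℕ) :
    volume (regularLevel N i) = volume (regularLevel N j) := by
  have hle : ∀ i j, volume (regularLevel N i) ≤ volume (regularLevel N j) := by
    intro i j
    rw [← measure_preimage_add_right volume
      (cellShift N (levelCell (N + 1) i) (levelCell (N + 1) j)) (regularLevel N j)]
    refine measure_mono fun x hx => ⟨(add_mem_regularPoints_iff (isDyadic_cellShift _ _ _)).2 hx.1,
      cellOf_add_cellShift hx.2 (levelCell_lt _ _).1 (levelCell_lt _ _).2⟩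
  exact le_antisymm (hle i j) (hle j i)

theorem add_quarterShift_mem_level {N m i p q : ℕ} {x : Torus2}
    (hx : x ∈ regularLevel N i ∩ quarterSet (N + m) p) :
    x + quarterShift (N + m) p q ∈ regularLevel N i ∩ quarterSet (N + m) q := by
  obtain ⟨hxl, hr, j, h1, hj, hc⟩ := hx
  have hs := add_quarterShift_mem_quarterSet q ⟨hr, j, h1, hj, hc⟩
  refine ⟨⟨hs.1, (cellOf_eq_of_add (m := m) ?_).trans hxl.2⟩, hs⟩
  rw [cellOf_eq_of_succ hc]
  refine cellOf_eq_of_succ (q := q) ?_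
  rw [← cellShift_cellQuarter_same (N + m) (levelCell (N + m + 1) j)]
  have := cellQuarter_lt (levelCell_lt (N + m) j) q
  exact cellOf_add_cellShift hc this.1 this.2

/-- The level splits into the four kinds of quarters of finer cells, and each kind is translated
into the second one inside the level. -/
theorem volume_regularLevel_le {N i : ℕ} (hi : 1 ≤ i ∧ i ≤ columnHeight (N + 1)) (m : ℕ) :
    volume (regularLevel N i) ≤ 4 * volume (regularLevel N i ∩ quarterSet (N + m) 2) := by
  have hle : ∀ p, volume (regularLevel N i ∩ quarterSet (N + m) p) ≤
      volume (regularLevel N i ∩ quarterSet (N + m) 2) := by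
    intro p
    rw [← measure_preimage_add_right volume (quarterShift (N + m) p 2)
      (regularLevel N i ∩ quarterSet (N + m) 2)]
    exact measure_mono fun x hx => add_quarterShift_mem_level hx
  calc volume (regularLevel N i)
      ≤ volume (⋃ q ∈ Finset.Icc 1 4, regularLevel N i ∩ quarterSet (N + m) q) := by
        refine measure_mono fun x hx => ?_
        obtain ⟨j, h1, hj, hc⟩ := exists_levelCell_add hi hx.2 m
        obtain ⟨q, hq1, hq4, hq⟩ := exists_cellQuarter (cellOf_succ_div (N + m) x).1
          (cellOf_succ_div (N + m) x).2
        exact mem_biUnion (Finset.mem_Icc.2 ⟨hq1, hq4⟩) ⟨hx, hx.1, j, h1, hj, by rw [hq, hc]⟩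
    _ ≤ ∑ q ∈ Finset.Icc 1 4, volume (regularLevel N i ∩ quarterSet (N + m) q) :=
        measure_biUnion_finset_le _ _
    _ ≤ ∑ _q ∈ Finset.Icc 1 4, volume (regularLevel N i ∩ quarterSet (N + m) 2) :=
        Finset.sum_le_sum fun q _ => hle q
    _ = 4 * volume (regularLevel N i ∩ quarterSet (N + m) 2) := by simp

theorem level_recurrence {n i k : ℕ} (hn : 2 ≤ n) (h1 : 1 ≤ i) (hi : i ≤ columnHeight n)
    (hk : n ≤ k) : volume.real (level n i) / 4 ≤
      volume.real ((chaconMap^[columnHeight k]) '' level n i ∩ level n i) := by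
  obtain ⟨N, rfl⟩ := Nat.exists_eq_add_of_le' (one_le_two.trans hn)
  obtain ⟨m, rfl⟩ := Nat.exists_eq_add_of_le hk
  rw [show N + 1 + m = N + m + 1 by omega]
  have h := volume_regularLevel_le ⟨h1, hi⟩ m
  rw [← volume_level] at h
  -- A second-quarter point is the image of the corresponding first-quarter point of the same fine
  -- cell, which lies in the same level because `n ≤ k`.
  have hsub : regularLevel N i ∩ quarterSet (N + m) 2 ⊆
      (chaconMap^[columnHeight (N + m + 1)]) '' level (N + 1) i ∩ level (N + 1) i := by
    intro x hx
    have hx' := add_quarterShift_mem_level (q := 1) hx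
    refine ⟨⟨_, regularLevel_subset_level N i hx'.1, ?_⟩, regularLevel_subset_level N i hx.1⟩
    rw [chaconMap_iterate_of_mem_quarterSet_one hx'.2, add_assoc, quarterShift, quarterShift,
      cellShift_add_cellShift, cellShift_self, add_zero]
  have h2 := ENNReal.toReal_mono (by finiteness) (h.trans (mul_le_mul_right (measure_mono hsub) 4))
  rw [ENNReal.toReal_mul] at h2
  rw [div_le_iff₀' (by norm_num)]
  exact h2

/-! ### A small level and the failure of strong mixing. -/

theorem volume_level_three_one : 0 < volume.real (level 3 1) ∧ volume.real (level 3 1) < 1 / 4 := by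
  constructor
  · refine ENNReal.toReal_pos (ne_of_gt ?_) (measure_ne_top _ _)
    have hsub : openLevel 3 1 ⊆ level 3 1 :=
      image_mono (prod_mono Ioo_subset_Icc_self Ioo_subset_Icc_self)
    refine lt_of_lt_of_le ((isOpen_openSquare _ _).measure_pos volume ?_) (measure_mono hsub)
    have hl : 0 < levelSide 3 := by rw [levelSide]; positivity
    exact ((nonempty_Ioo.2 (lt_add_of_pos_right _ hl)).prod
      (nonempty_Ioo.2 (lt_add_of_pos_right _ hl))).image _
  -- Five disjoint levels of equal measure already force at most 1/5. Column 2 would not do: its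
  -- levels have measure exactly 1/4.
  · have hd : ((Finset.Icc 1 5 : Finset ℕ) : Set ℕ).PairwiseDisjoint (regularLevel 2) := by
      intro i hi j hj hij
      refine disjoint_left.2 fun x hx hy =>
        hij (levelCell_inj (N := 2) ?_ ?_ (hx.2.symm.trans hy.2))
      · exact ⟨(Finset.mem_Icc.1 hi).1, (Finset.mem_Icc.1 hi).2.trans (by decide)⟩
      · exact ⟨(Finset.mem_Icc.1 hj).1, (Finset.mem_Icc.1 hj).2.trans (by decide)⟩
    have h := measureReal_biUnion_finset (μ := volume) hd fun i _ => measurableSet_regularLevel 2 i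
    have he : ∀ i, volume.real (regularLevel 2 i) = volume.real (level 3 1) := fun i => by
      rw [measureReal_def, measureReal_def, volume_level 2 1, volume_regularLevel_eq 2 i 1]
    simp only [he] at h
    rw [Finset.sum_const, Nat.card_Icc, nsmul_eq_mul] at h
    have h1 := measureReal_le_one (μ := (volume : Measure Torus2))
      (s := ⋃ i ∈ Finset.Icc 1 5, regularLevel 2 i)
    rw [h] at h1
    norm_num at h1
    linarith

theorem tendsto_columnHeight : Tendsto columnHeight atTop atTop := by
  rw [← tendsto_add_atTop_iff_nat 1]
  refine tendsto_atTop_mono (fun n => ?_) tendsto_id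
  have h1 := columnHeight_add_one n
  have h2 := Nat.lt_pow_self (n := n) (a := 4) (by norm_num)
  simp only [id]
  omega

theorem not_isStronglyMixing_chaconMap : ¬ IsStronglyMixing chaconMap := by
  intro hmix
  have hm := measurableSet_level 3 1
  have hlim := (hmix _ _ hm hm).comp tendsto_columnHeight
  obtain ⟨hpos, hlt⟩ := volume_level_three_one
  have hge : volume.real (level 3 1) / 4 ≤ volume.real (level 3 1) * volume.real (level 3 1) := by
    refine ge_of_tendsto hlim ?_
    filter_upwards [eventually_ge_atTop 3] with k hk
    refine (level_recurrence (by norm_num) le_rfl (by decide) hk).trans_eq ?_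
    have hmp := measurePreserving_chaconMap.iterate (columnHeight k)
    have hinj := chaconMap_injective.iterate (columnHeight k)
    -- Recurrence speaks of images and mixing of preimages; pulling back by the injective
    -- measure-preserving iterate exchanges them.
    rw [← hmp.measureReal_preimage ((hm.image_of_measurable_injOn hmp.measurable
      hinj.injOn).inter hm).nullMeasurableSet, preimage_inter, preimage_image_eq _ hinj,
      Function.comp_apply, inter_comm]
  nlinarith

theorem mainTheorem2 :
    (∀ x : Torus2, Tendsto (fun n => chaconStep n x) atTop (𝓝 (chaconMap x))) ∧
    IsTorusAutomorphism chaconMap ∧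
    IsWeaklyMixing chaconMap ∧
    ¬ IsStronglyMixing chaconMap ∧
    (∀ n i k : ℕ, 2 ≤ n → 1 ≤ i → i ≤ columnHeight n → n ≤ k →
      volume.real (level n i) / 4 ≤
        volume.real ((chaconMap^[columnHeight k]) '' level n i ∩ level n i)) ∧
    (∃ hU : MeasurePreserving chaconMap volume volume, ∀ z : ℂ,
      Module.End.HasEigenvalue
        (Lp.compMeasurePreservingₗᵢ (E := ℂ) (p := 2) ℂ chaconMap hU).toLinearMap z → z = 1) :=
  ⟨tendsto_chaconStep, isTorusAutomorphism_chaconMap, isWeaklyMixing_chaconMap,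
    not_isStronglyMixing_chaconMap, fun _ _ _ hn h1 hi hk => level_recurrence hn h1 hi hk,
    measurePreserving_chaconMap,
    fun _ hz => eigenvalue_eq_one_of_ergodic_prodMap ergodic_prodMap_chaconMap _ hz⟩
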